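/- Let $n\ge 1$ and let $\triangle=\{(x_1,\dots,x_n)\in\mathbb R^n : 1\ge x_1\ge\cdots\ge x_n\ge 0\}$. For $b=0,1,2,\dots$ put $$\triangle_b=\{x\in\triangle : 1-x_1-bx_n\ge 0>1-x_1-(b+1)x_n\};$$ these sets partition $\{x\in\triangle : x_n>0\}$, which is almost all of $\triangle$. The (fast) triangle map $T:\triangle\to\triangle$ is $$T(x_1,\dots,x_n)=\left(\frac{x_2}{x_1},\dots,\frac{x_n}{x_1},\frac{1-x_1-bx_n}{x_1}\right)\qquad\text{for } x\in\triangle_b,$$ and, by convention, $T(x)=(0,\dots,0)$ on the null set $\{x\in\triangle : x_n=0\}$ (for $n=1$ this is the Gauss map). Then $T$ is ergodic with respect to Lebesgue measure $\lambda$ on $\triangle$: $T$ is measurable, $\lambda(T^{-1}(A))=0$ for every measurable $A\subseteq\triangle$ with $\lambda(A)=0$, and every measurable $A\subseteq\triangle$ with $T^{-1}(A)=A$ satisfies $\lambda(A)=0$ or $\lambda(\triangle\setminus A)=0$. -/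

import Mathlib

open MeasureTheory

namespace TriangleMap

/-- The simplex `{x ∈ ℝⁿ : 1 ≥ x₁ ≥ ⋯ ≥ xₙ ≥ 0}`; the coordinate `xᵢ₊₁` is `x i`. -/
def simplex (n : ℕ) : Set (Fin n → ℝ) :=
  {x | (∀ i, x i ≤ 1) ∧ Antitone x ∧ ∀ i, 0 ≤ x i}

/-- The piece `{x ∈ simplex : 1 - x₁ - b xₙ ≥ 0 > 1 - x₁ - (b + 1) xₙ}`, in dimension `m + 1`. -/
def piece (m b : ℕ) : Set (Fin (m + 1) → ℝ) :=
  {x | x ∈ simplex (m + 1) ∧ 0 ≤ 1 - x 0 - b * x (Fin.last m) ∧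
    1 - x 0 - (b + 1) * x (Fin.last m) < 0}

/-- The digit `b = ⌊(1 - x₁) / xₙ⌋`. -/
noncomputable def digit {m : ℕ} (x : Fin (m + 1) → ℝ) : ℕ :=
  ⌊(1 - x 0) / x (Fin.last m)⌋₊

/-- The formula `(x₂ / x₁, …, xₙ / x₁, (1 - x₁ - b xₙ) / x₁)` in dimension `n = m + 1`. -/
noncomputable def branch {m : ℕ} (b : ℕ) (x : Fin (m + 1) → ℝ) : Fin (m + 1) → ℝ :=
  Fin.snoc (α := fun _ => ℝ) (fun i : Fin m => x i.succ / x 0)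
    ((1 - x 0 - b * x (Fin.last m)) / x 0)

/-- The pieces partition the part of the simplex where the last coordinate is nonzero,
and on it the piece containing `x` is the one indexed by `digit x`. -/
theorem mem_piece_iff {m b : ℕ} {x : Fin (m + 1) → ℝ} :
    x ∈ piece m b ↔ x ∈ simplex (m + 1) ∧ x (Fin.last m) ≠ 0 ∧ digit x = b := by
  constructor
  · rintro ⟨hx, h1, h2⟩
    have h0 : x (Fin.last m) ≠ 0 := by
      intro h
      rw [h] at h1 h2
      linarith
    have hp : 0 < x (Fin.last m) := lt_of_le_of_ne (hx.2.2 _) h0.symm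
    refine ⟨hx, h0, ?_⟩
    rw [digit, Nat.floor_eq_iff (div_nonneg (by linarith [hx.1 0]) hp.le), le_div_iff₀ hp,
      div_lt_iff₀ hp]
    constructor <;> linarith
  · rintro ⟨hx, h0, hb⟩
    have hp : 0 < x (Fin.last m) := lt_of_le_of_ne (hx.2.2 _) h0.symm
    rw [digit, Nat.floor_eq_iff (div_nonneg (by linarith [hx.1 0]) hp.le), le_div_iff₀ hp,
      div_lt_iff₀ hp] at hb
    exact ⟨hx, by linarith [hb.1], by linarith [hb.2]⟩

theorem branch_mem_simplex {m b : ℕ} {x : Fin (m + 1) → ℝ} (hx : x ∈ piece m b) :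
    branch b x ∈ simplex (m + 1) := by
  have h0 := (mem_piece_iff.1 hx).2.1
  obtain ⟨⟨h1, ha, hn⟩, hb1, hb2⟩ := hx
  have hl : 0 < x (Fin.last m) := lt_of_le_of_ne (hn _) h0.symm
  have hp : 0 < x 0 := hl.trans_le (ha (Fin.zero_le _))
  have hlast : (1 - x 0 - b * x (Fin.last m)) / x 0 ≤ x (Fin.last m) / x 0 := by
    gcongr
    linarith
  refine ⟨fun i => ?_, fun i j hij => ?_, fun i => ?_⟩
  · induction i using Fin.lastCases with
    | last =>
      simp only [branch, Fin.snoc_last]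
      exact hlast.trans ((div_le_one hp).2 (ha (Fin.zero_le _)))
    | cast i =>
      simp only [branch, Fin.snoc_castSucc]
      exact (div_le_one hp).2 (ha (Fin.zero_le _))
  · induction j using Fin.lastCases with
    | last =>
      induction i using Fin.lastCases with
      | last => exact le_rfl
      | cast i =>
        simp only [branch, Fin.snoc_last, Fin.snoc_castSucc]
        refine hlast.trans ?_
        gcongr
        exact ha (Fin.le_last _)
    | cast j =>
      induction i using Fin.lastCases with
      | last => exact absurd hij (not_le.2 (Fin.castSucc_lt_last j))
      | cast i =>
        simp only [branch, Fin.snoc_castSucc]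
        gcongr
        exact ha (Fin.succ_le_succ_iff.2 (Fin.castSucc_le_castSucc_iff.1 hij))
  · induction i using Fin.lastCases with
    | last =>
      simp only [branch, Fin.snoc_last]
      exact div_nonneg hb1 hp.le
    | cast i =>
      simp only [branch, Fin.snoc_castSucc]
      exact div_nonneg (hn _) hp.le

theorem zero_mem_simplex (n : ℕ) : (0 : Fin n → ℝ) ∈ simplex n :=
  ⟨fun _ => zero_le_one, fun _ _ _ => le_rfl, fun _ => le_rfl⟩

open Classical in
/-- The (fast) triangle map on the simplex of dimension `m + 1`: on the piece with digit `b` it is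
`branch b`. The face `xₙ = 0`, a null set which meets no piece, is sent to the origin
(as is customary for the Gauss map, the case of dimension one). -/
noncomputable def triangleMap (m : ℕ) (x : simplex (m + 1)) : simplex (m + 1) :=
  if h : x.1 (Fin.last m) = 0 then ⟨0, zero_mem_simplex _⟩
  else ⟨branch (digit x.1) x.1, branch_mem_simplex (mem_piece_iff.2 ⟨x.2, h, rfl⟩)⟩

end TriangleMap

namespace TriangleMap

open Set Matrix
open scoped ENNReal Pointwise

variable {m : ℕ}


/-! In homogeneous coordinates the simplex becomes the positive orthant of dimension `m + 2`. The
inverse branches become nonnegative integer matrices, each a cyclic rotation followed by two shears,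
so they preserve volume. Sets invariant under the map correspond to cones invariant under
`inverseBranch b` for every `b`, and null sets to null sets.

Volume is measured in the corners `q ⬝ᵥ y < 1` of the orthant. In the coordinates of the cylinder of
a word, a corner is again a corner, with the weight `weightWord q w`. Statements uniform in `q`
therefore hold conditionally on any initial digits, although no invariant measure is used.

A digit `b` is tame if `b * q 0 ≤ q (Fin.last _)`. At least half of every corner has a tame first
digit (`half_volume_corner_le`), so `m + 1` tame digits in a row have conditional probability at
least `2⁻¹ ^ (m + 1)`, and almost every point meets such a block after any cylinder
(`volume_corner_diff_tamePoints`). A tame block does two things. It makes all weights comparable up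
to `3 ^ (m + 1)` (`isBalanced_append`), so the cylinder is distorted boundedly. It also contracts
the oscillation of the ratios of two weights by a fixed factor (`IsTame.exists_pinch`), so cylinders
shrink to single directions.

The conclusion is a density argument. By `IsBalanced.mul_volume_le`, an invariant cone `A` of
positive measure fills a definite proportion of each balanced cylinder. Narrow balanced cylinders
cover almost all of the complement of `A` inside an open set that contains little of `A`, which
forces the complement to be null. -/

/-! ### Linear inverse branches, weights and cylinders -/

/-- In the homogeneous coordinates `yᵢ = xᵢ - xᵢ₊₁`, the linear map inverting the branch of the
triangle map with digit `b`. -/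
def inverseBranch (b : ℕ) (y : Fin (m + 2) → ℝ) : Fin (m + 2) → ℝ :=
  Fin.cons (α := fun _ => ℝ)
    (y (Fin.last _) + b * (y (Fin.last m).castSucc + y (Fin.last _)))
    (Fin.snoc (α := fun _ => ℝ) (fun i : Fin m => y i.castSucc.castSucc)
      (y (Fin.last m).castSucc + y (Fin.last _)))

/-- The transpose of `inverseBranch`. -/
def weightStep (q : Fin (m + 2) → ℝ) (b : ℕ) : Fin (m + 2) → ℝ :=
  Fin.snoc (α := fun _ => ℝ)
    (Fin.snoc (α := fun _ => ℝ) (fun i : Fin m => q i.castSucc.succ) (q (Fin.last _) + b * q 0))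
    (q (Fin.last _) + (b + 1) * q 0)

/-- The inverse of the composition of branches with the digits listed in a word. -/
def inverseWord : List ℕ → (Fin (m + 2) → ℝ) → Fin (m + 2) → ℝ
  | [], y => y
  | b :: w, y => inverseBranch b (inverseWord w y)

/-- The transpose of `inverseWord`. -/
def weightWord (q : Fin (m + 2) → ℝ) (w : List ℕ) : Fin (m + 2) → ℝ :=
  w.foldl weightStep q

/-- The open positive orthant. -/
def orthant (m : ℕ) : Set (Fin (m + 2) → ℝ) := {y | ∀ i, 0 < y i}

/-- The cone of the points whose first digits are the given ones. -/
def cylinder (m : ℕ) (w : List ℕ) : Set (Fin (m + 2) → ℝ) := inverseWord w '' orthant m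

@[simp] theorem inverseBranch_zero (b : ℕ) (y : Fin (m + 2) → ℝ) :
    inverseBranch b y 0 =
      y (Fin.last _) + b * (y (Fin.last m).castSucc + y (Fin.last _)) := rfl

@[simp] theorem inverseBranch_succ_castSucc (b : ℕ) (y : Fin (m + 2) → ℝ) (i : Fin m) :
    inverseBranch b y i.castSucc.succ = y i.castSucc.castSucc := by
  simp [inverseBranch]

@[simp] theorem inverseBranch_last (b : ℕ) (y : Fin (m + 2) → ℝ) :
    inverseBranch b y (Fin.last _) = y (Fin.last m).castSucc + y (Fin.last _) := by
  rw [← Fin.succ_last]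
  simp [inverseBranch]

@[simp] theorem weightStep_castSucc_castSucc (q : Fin (m + 2) → ℝ) (b : ℕ) (i : Fin m) :
    weightStep q b i.castSucc.castSucc = q i.castSucc.succ := by
  simp [weightStep]

@[simp] theorem weightStep_castSucc_last (q : Fin (m + 2) → ℝ) (b : ℕ) :
    weightStep q b (Fin.last m).castSucc = q (Fin.last _) + b * q 0 := by
  simp [weightStep]

@[simp] theorem weightStep_last (q : Fin (m + 2) → ℝ) (b : ℕ) :
    weightStep q b (Fin.last _) = q (Fin.last _) + (b + 1) * q 0 := by
  simp [weightStep]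

theorem forall_weightStep {p : ℝ → Prop} {q : Fin (m + 2) → ℝ} {b : ℕ}
    (h : ∀ i : Fin m, p (q i.castSucc.succ)) (h1 : p (q (Fin.last _) + b * q 0))
    (h2 : p (q (Fin.last _) + (b + 1) * q 0)) (i : Fin (m + 2)) : p (weightStep q b i) := by
  induction i using Fin.lastCases with
  | last => simpa using h2
  | cast i =>
    induction i using Fin.lastCases with
    | last => simpa using h1
    | cast i => simpa using h i

theorem dotProduct_inverseBranch (q y : Fin (m + 2) → ℝ) (b : ℕ) :
    q ⬝ᵥ inverseBranch b y = weightStep q b ⬝ᵥ y := by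
  simp only [dotProduct]
  rw [Fin.sum_univ_succ, Fin.sum_univ_castSucc, Fin.sum_univ_castSucc, Fin.sum_univ_castSucc]
  simp only [Fin.succ_last, inverseBranch_zero, inverseBranch_last, inverseBranch_succ_castSucc,
    weightStep_castSucc_castSucc, weightStep_castSucc_last, weightStep_last]
  ring

theorem dotProduct_inverseWord (q y : Fin (m + 2) → ℝ) (w : List ℕ) :
    q ⬝ᵥ inverseWord w y = weightWord q w ⬝ᵥ y := by
  induction w generalizing q with
  | nil => rfl
  | cons b w ih =>
    rw [inverseWord, dotProduct_inverseBranch, ih]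
    rfl

theorem inverseWord_append (v w : List ℕ) (y : Fin (m + 2) → ℝ) :
    inverseWord (v ++ w) y = inverseWord v (inverseWord w y) := by
  induction v with
  | nil => rfl
  | cons b v ih => simp [inverseWord, ih]

theorem weightWord_append (q : Fin (m + 2) → ℝ) (v w : List ℕ) :
    weightWord q (v ++ w) = weightWord (weightWord q v) w := by
  simp [weightWord]

theorem inverseBranch_mem_orthant {y : Fin (m + 2) → ℝ} (hy : y ∈ orthant m) (b : ℕ) :
    inverseBranch b y ∈ orthant m := by
  have h1 := hy (Fin.last _)
  have h2 := hy (Fin.last m).castSucc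
  intro i
  induction i using Fin.cases with
  | zero => rw [inverseBranch_zero]; positivity
  | succ i =>
    induction i using Fin.lastCases with
    | last => rw [Fin.succ_last, inverseBranch_last]; positivity
    | cast i => rw [inverseBranch_succ_castSucc]; exact hy _

theorem inverseWord_mem_orthant {y : Fin (m + 2) → ℝ} (hy : y ∈ orthant m) (w : List ℕ) :
    inverseWord w y ∈ orthant m := by
  induction w with
  | nil => exact hy
  | cons b w ih => exact inverseBranch_mem_orthant ih b

theorem weightStep_mem_orthant {q : Fin (m + 2) → ℝ} (hq : q ∈ orthant m) (b : ℕ) :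
    weightStep q b ∈ orthant m := by
  have h0 := hq 0
  have h1 := hq (Fin.last _)
  exact forall_weightStep (fun i => hq _) (by positivity) (by positivity)

theorem weightWord_mem_orthant {q : Fin (m + 2) → ℝ} (hq : q ∈ orthant m) (w : List ℕ) :
    weightWord q w ∈ orthant m := by
  induction w generalizing q with
  | nil => exact hq
  | cons b w ih => exact ih (weightStep_mem_orthant hq b)

theorem inverseBranch_injective (b : ℕ) :
    Function.Injective (inverseBranch b : (Fin (m + 2) → ℝ) → _) := by
  intro y z h
  have h0 := congrFun h 0
  have h1 := congrFun h (Fin.last _)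
  rw [inverseBranch_zero, inverseBranch_zero] at h0
  rw [inverseBranch_last, inverseBranch_last] at h1
  rw [h1] at h0
  have h2 : y (Fin.last _) = z (Fin.last _) := by linarith
  funext i
  induction i using Fin.lastCases with
  | last => exact h2
  | cast i =>
    induction i using Fin.lastCases with
    | last => linarith
    | cast i => simpa using congrFun h i.castSucc.succ

theorem inverseWord_injective (w : List ℕ) :
    Function.Injective (inverseWord w : (Fin (m + 2) → ℝ) → _) := by
  induction w with
  | nil => exact Function.injective_id
  | cons b w ih => exact (inverseBranch_injective b).comp ih

/-- The digit can be read off from the image as the integer part of the first coordinate over the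
last; hence images under distinct digits are disjoint. -/
theorem inverseBranch_mul_last_lt {y : Fin (m + 2) → ℝ} (hy : y ∈ orthant m) (b : ℕ) :
    b * inverseBranch b y (Fin.last _) < inverseBranch b y 0 ∧
      inverseBranch b y 0 < (b + 1) * inverseBranch b y (Fin.last _) := by
  rw [inverseBranch_zero, inverseBranch_last]
  have h1 := hy (Fin.last _)
  have h2 := hy (Fin.last m).castSucc
  constructor <;> linarith

theorem inverseBranch_eq_iff {y z : Fin (m + 2) → ℝ} (hy : y ∈ orthant m) (hz : z ∈ orthant m)
    {b c : ℕ} : inverseBranch b y = inverseBranch c z ↔ b = c ∧ y = z := by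
  refine ⟨fun h => ?_, fun h => by rw [h.1, h.2]⟩
  have hb := inverseBranch_mul_last_lt hy b
  have hc := inverseBranch_mul_last_lt hz c
  rw [← h] at hc
  have hp := inverseBranch_mem_orthant hy b (Fin.last _)
  have h1 : (b : ℝ) < c + 1 := lt_of_mul_lt_mul_right (hb.1.trans hc.2) hp.le
  have h2 : (c : ℝ) < b + 1 := lt_of_mul_lt_mul_right (hc.1.trans hb.2) hp.le
  norm_cast at h1 h2
  obtain rfl : b = c := by omega
  exact ⟨rfl, inverseBranch_injective b h⟩

/-- A point whose first coordinate is not a multiple of the last one has a digit. -/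
theorem exists_inverseBranch_eq {y : Fin (m + 2) → ℝ} (hy : y ∈ orthant m)
    (h : ∀ b : ℕ, y 0 ≠ b * y (Fin.last _)) : ∃ b, ∃ z ∈ orthant m, inverseBranch b z = y := by
  have hl := hy (Fin.last _)
  set b := ⌊y 0 / y (Fin.last _)⌋₊ with hb
  have h1 : (b : ℝ) * y (Fin.last _) < y 0 := by
    refine lt_of_le_of_ne ?_ (h b).symm
    rw [← le_div_iff₀ hl]
    exact Nat.floor_le (div_nonneg (hy 0).le hl.le)
  have h2 : y 0 < (b + 1) * y (Fin.last _) := by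
    rw [← div_lt_iff₀ hl]
    exact Nat.lt_floor_add_one _
  refine ⟨b, Fin.snoc (α := fun _ => ℝ) (Fin.snoc (α := fun _ => ℝ)
    (fun i : Fin m => y i.castSucc.succ) (y (Fin.last _) - (y 0 - b * y (Fin.last _))))
    (y 0 - b * y (Fin.last _)), ?_, ?_⟩
  · intro i
    induction i using Fin.lastCases with
    | last => simpa using h1
    | cast i =>
      induction i using Fin.lastCases with
      | last => rw [Fin.snoc_castSucc, Fin.snoc_last]; linarith
      | cast i => simpa using hy _
  · funext i
    induction i using Fin.cases with
    | zero => rw [inverseBranch_zero, Fin.snoc_castSucc, Fin.snoc_last, Fin.snoc_last]; ring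
    | succ i =>
      induction i using Fin.lastCases with
      | last => rw [Fin.succ_last, inverseBranch_last, Fin.snoc_castSucc, Fin.snoc_last,
          Fin.snoc_last]; ring
      | cast i => simp

theorem cylinder_cons (b : ℕ) (w : List ℕ) :
    cylinder m (b :: w) = inverseBranch b '' cylinder m w := by
  rw [cylinder, cylinder, image_image]
  rfl

theorem cylinder_subset_orthant (w : List ℕ) : cylinder m w ⊆ orthant m := by
  rintro _ ⟨y, hy, rfl⟩
  exact inverseWord_mem_orthant hy w

theorem cylinder_append_subset (v w : List ℕ) : cylinder m (v ++ w) ⊆ cylinder m v := by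
  rintro _ ⟨y, hy, rfl⟩
  exact ⟨_, inverseWord_mem_orthant hy w, (inverseWord_append v w y).symm⟩

theorem inverseBranch_mem_cylinder_cons {y : Fin (m + 2) → ℝ} (hy : y ∈ orthant m) {b c : ℕ}
    {w : List ℕ} : inverseBranch b y ∈ cylinder m (c :: w) ↔ b = c ∧ y ∈ cylinder m w := by
  rw [cylinder_cons]
  constructor
  · rintro ⟨z, hz, h⟩
    obtain ⟨rfl, rfl⟩ := (inverseBranch_eq_iff (cylinder_subset_orthant w hz) hy).1 h
    exact ⟨rfl, hz⟩
  · rintro ⟨rfl, h⟩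
    exact ⟨y, h, rfl⟩

theorem prefix_or_prefix_of_mem_cylinder {y : Fin (m + 2) → ℝ} {v w : List ℕ}
    (hv : y ∈ cylinder m v) (hw : y ∈ cylinder m w) : v <+: w ∨ w <+: v := by
  induction v generalizing y w with
  | nil => exact Or.inl w.nil_prefix
  | cons b v ih =>
    cases w with
    | nil => exact Or.inr (List.nil_prefix)
    | cons c w =>
      rw [cylinder_cons] at hv
      obtain ⟨z, hz, rfl⟩ := hv
      obtain ⟨rfl, hzw⟩ :=
        (inverseBranch_mem_cylinder_cons (cylinder_subset_orthant v hz)).1 hw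
      simpa using ih hz hzw

/-! ### Growth of the weights -/

/-- A word is tame for a weight if its digits keep the growth of the weight bounded. -/
def IsTame : (Fin (m + 2) → ℝ) → List ℕ → Prop
  | _, [] => True
  | q, b :: w => b * q 0 ≤ q (Fin.last _) ∧ IsTame (weightStep q b) w

/-- The last entry is the largest. -/
def MaxLast (q : Fin (m + 2) → ℝ) : Prop := ∀ i, q i ≤ q (Fin.last _)

theorem MaxLast.weightStep {q : Fin (m + 2) → ℝ} (h : MaxLast q) (hq : q ∈ orthant m) (b : ℕ) :
    MaxLast (weightStep q b) := by
  have h0 := hq 0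
  intro i
  rw [weightStep_last]
  refine forall_weightStep (p := fun t => t ≤ q (Fin.last _) + (b + 1) * q 0)
    (fun i => (h _).trans ?_) ?_ le_rfl i
  · have : 0 ≤ ((b : ℝ) + 1) * q 0 := by positivity
    linarith
  · linarith

theorem MaxLast.weightWord {q : Fin (m + 2) → ℝ} (h : MaxLast q) (hq : q ∈ orthant m)
    (w : List ℕ) : MaxLast (weightWord q w) := by
  induction w generalizing q with
  | nil => exact h
  | cons b w ih => exact ih (h.weightStep hq b) (weightStep_mem_orthant hq b)

theorem IsTame.weightWord_last_le {q : Fin (m + 2) → ℝ} (hq : q ∈ orthant m) (h : MaxLast q)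
    {w : List ℕ} (hw : IsTame q w) :
    weightWord q w (Fin.last _) ≤ 3 ^ w.length * q (Fin.last _) := by
  induction w generalizing q with
  | nil => simp [weightWord]
  | cons b w ih =>
    refine (ih (weightStep_mem_orthant hq b) (h.weightStep hq b) hw.2).trans ?_
    rw [weightStep_last, List.length_cons, pow_succ, mul_assoc]
    gcongr
    linarith [hw.1, h 0]

/-- Each step shifts the entries down by one place and appends two entries that are at least the old
last one. The block of final entries known to be at least `η` thus grows by one per step; `k + 1` is
its length. -/
theorem le_weightWord {s : Fin (m + 2) → ℝ} {η : ℝ} {w : List ℕ} {k : ℕ}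
    (hs : ∀ i, 0 ≤ s i) (hk : ∀ i : Fin (m + 2), m + 1 ≤ i + k → η ≤ s i)
    (hw : m + 1 ≤ w.length + k) (i : Fin (m + 2)) : η ≤ weightWord s w i := by
  induction w generalizing s k with
  | nil =>
    refine hk i ?_
    simp at hw
    omega
  | cons b w ih =>
    have h0 := hs 0
    have hl0 := hs (Fin.last _)
    have hl : η ≤ s (Fin.last _) := hk _ (by simp)
    refine ih (s := weightStep s b) (k := k + 1)
      (forall_weightStep (fun i => hs _) (by positivity) (by positivity)) (fun i hi => ?_)
      (by simp at hw; omega)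
    have h1 : η ≤ s (Fin.last _) + b * s 0 := hl.trans (by simp; positivity)
    have h2 : η ≤ s (Fin.last _) + (b + 1) * s 0 := by linarith
    induction i using Fin.lastCases with
    | last => simpa using h2
    | cast i =>
      induction i using Fin.lastCases with
      | last => simpa using h1
      | cast i =>
        rw [weightStep_castSucc_castSucc]
        refine hk _ ?_
        simp at hi ⊢
        omega

theorem last_le_weightWord {s : Fin (m + 2) → ℝ} (hs : ∀ i, 0 ≤ s i) {w : List ℕ}
    (hw : w.length = m + 1) (i : Fin (m + 2)) : s (Fin.last _) ≤ weightWord s w i := by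
  refine le_weightWord (k := 0) hs (fun i hi => ?_) (by omega) i
  rw [show i = Fin.last _ from Fin.ext (by simp; omega)]

theorem weightWord_sub_smul (r q : Fin (m + 2) → ℝ) (a : ℝ) (w : List ℕ) :
    weightWord (r - a • q) w = weightWord r w - a • weightWord q w := by
  induction w generalizing r q with
  | nil => rfl
  | cons b w ih =>
    have : weightStep (r - a • q) b = weightStep r b - a • weightStep q b := by
      funext i
      induction i using Fin.lastCases with
      | last => simp; ring
      | cast i =>
        induction i using Fin.lastCases with
        | last => simp; ring
        | cast i => simp
    simp only [weightWord, List.foldl_cons, this] at ih ⊢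
    exact ih _ _

theorem weightWord_nonneg {s : Fin (m + 2) → ℝ} (hs : ∀ i, 0 ≤ s i) (w : List ℕ)
    (i : Fin (m + 2)) : 0 ≤ weightWord s w i :=
  le_weightWord (k := m + 1) hs (fun i _ => hs i) (by omega) i

/-- The rate by which the oscillation of a ratio decreases along a tame word of length `m + 1`. -/
noncomputable def pinchRate (m : ℕ) : ℝ := 1 - (3 ^ (m + 1) : ℝ)⁻¹ / 2

theorem weightWord_mono {a : ℝ} {r q : Fin (m + 2) → ℝ} (h : ∀ i, a * q i ≤ r i) (w : List ℕ)
    (i : Fin (m + 2)) : a * weightWord q w i ≤ weightWord r w i := by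
  have := weightWord_nonneg (s := r - a • q) (fun i => by simpa using h i) w i
  rw [weightWord_sub_smul] at this
  simpa using this

theorem weightWord_neg (q : Fin (m + 2) → ℝ) (w : List ℕ) :
    weightWord (-q) w = -weightWord q w := by
  have h0 := weightWord_sub_smul q q 1 w
  have h := weightWord_sub_smul (q - (1 : ℝ) • q) q 1 w
  rw [h0] at h
  simpa using h

theorem weightWord_mono_right {b : ℝ} {r q : Fin (m + 2) → ℝ} (h : ∀ i, r i ≤ b * q i)
    (w : List ℕ) (i : Fin (m + 2)) : weightWord r w i ≤ b * weightWord q w i := by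
  have := weightWord_mono (a := -b) (r := -r) (q := q) (fun i => by simpa using h i) w i
  rw [weightWord_neg] at this
  simpa using this

/-- The surplus `r - a • q` is nonnegative and its last entry is at least `t * q (Fin.last _)`.
After `m + 1` steps this reaches every entry, while tameness keeps the entries of the weight of `q`
below `3 ^ (m + 1) * q (Fin.last _)`. -/
theorem IsTame.add_mul_weightWord_le {q r : Fin (m + 2) → ℝ} (hq : q ∈ orthant m)
    (hm : MaxLast q) {u : List ℕ} (hu : IsTame q u) (hl : u.length = m + 1) {a t : ℝ}
    (ht : 0 ≤ t) (ha : ∀ i, a * q i ≤ r i)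
    (h : (a + t) * q (Fin.last _) ≤ r (Fin.last _)) (i : Fin (m + 2)) :
    (a + t * (3 ^ (m + 1) : ℝ)⁻¹) * weightWord q u i ≤ weightWord r u i := by
  have h1 := last_le_weightWord (s := r - a • q) (fun i => by simpa using ha i) hl i
  rw [weightWord_sub_smul] at h1
  simp only [Pi.sub_apply, Pi.smul_apply, smul_eq_mul] at h1
  have h2 := hu.weightWord_last_le hq hm
  have h3 := hm.weightWord hq u i
  rw [hl] at h2
  have h4 : (3 ^ (m + 1) : ℝ)⁻¹ * weightWord q u i ≤ q (Fin.last _) := by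
    rw [inv_mul_le_iff₀ (by positivity)]
    exact h3.trans h2
  nlinarith [mul_le_mul_of_nonneg_left h4 ht]

/-- The ratio `r / q` at the last index lies on one side of the midpoint of `[a, b]`, so the
opposite endpoint can be moved inwards by a fixed fraction of the half-width. -/
theorem IsTame.exists_pinch {q r : Fin (m + 2) → ℝ} (hq : q ∈ orthant m) (hm : MaxLast q)
    {u : List ℕ} (hu : IsTame q u) (hl : u.length = m + 1) {a b : ℝ} (hab : a ≤ b)
    (ha : ∀ i, a * q i ≤ r i) (hb : ∀ i, r i ≤ b * q i) :
    ∃ a' b', a' ≤ b' ∧ b' - a' ≤ pinchRate m * (b - a) ∧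
      (∀ i, a' * weightWord q u i ≤ weightWord r u i) ∧
      ∀ i, weightWord r u i ≤ b' * weightWord q u i := by
  have hδ : 0 < (3 ^ (m + 1) : ℝ)⁻¹ := by positivity
  have hδ1 : (3 ^ (m + 1) : ℝ)⁻¹ ≤ 1 := inv_le_one_of_one_le₀ (one_le_pow₀ (by norm_num))
  have hA := weightWord_mono ha u
  have hb' : ∀ i, (-b) * q i ≤ (-r) i := fun i => by simpa using hb i
  have hB := weightWord_mono_right hb u
  have ht : 0 ≤ (b - a) / 2 := by linarith
  rcases le_total ((a + (b - a) / 2) * q (Fin.last _)) (r (Fin.last _)) with h | h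
  · refine ⟨a + (b - a) / 2 * (3 ^ (m + 1) : ℝ)⁻¹, b, by nlinarith, ?_,
      hu.add_mul_weightWord_le hq hm hl ht ha h, hB⟩
    rw [pinchRate]
    linarith
  · refine ⟨a, b - (b - a) / 2 * (3 ^ (m + 1) : ℝ)⁻¹, by nlinarith, ?_, hA, fun i => ?_⟩
    · rw [pinchRate]
      linarith
    -- The upper endpoint is the lower endpoint for `-r`.
    · have := hu.add_mul_weightWord_le hq hm hl ht hb' (by simp; linarith) i
      rw [weightWord_neg] at this
      simp only [Pi.neg_apply] at this
      linarith


/-! ### Volume preservation and measurability -/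

theorem measurePreserving_shear {ι : Type*} [Fintype ι] [DecidableEq ι] {i j : ι} (hij : i ≠ j)
    (c : ℝ) :
    MeasurePreserving (fun y : ι → ℝ => Function.update y i (y i + c * y j)) := by
  convert Real.volume_preserving_transvectionStruct (⟨i, j, hij, c⟩ : TransvectionStruct ι ℝ)
    using 1
  funext y k
  rw [toLin'_apply, TransvectionStruct.toMatrix, transvection, add_mulVec, one_mulVec]
  rcases eq_or_ne k i with rfl | hk
  · simp [single_mulVec]
  · simp [single_mulVec, hk]

/-- The map is a cyclic rotation of the coordinates, then the first coordinate added to the last,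
then `b` times the last added to the first. -/
theorem measurePreserving_inverseBranch (b : ℕ) :
    MeasurePreserving (inverseBranch b : (Fin (m + 2) → ℝ) → _) := by
  have h1 := volume_measurePreserving_piCongrLeft (fun _ : Fin (m + 2) => ℝ) (finRotate (m + 2))
  have hne : Fin.last (m + 1) ≠ 0 := Fin.last_pos.ne'
  suffices h : (inverseBranch b : (Fin (m + 2) → ℝ) → _) = _ from
    h ▸ (measurePreserving_shear hne.symm b).comp ((measurePreserving_shear hne 1).comp h1)
  funext y i
  have hr : ∀ j, MeasurableEquiv.piCongrLeft (fun _ : Fin (m + 2) => ℝ) (finRotate (m + 2)) y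
      (finRotate (m + 2) j) = y j := fun j => by
    rw [MeasurableEquiv.coe_piCongrLeft, Equiv.piCongrLeft_apply_apply]
  have hr0 := hr (Fin.last _)
  rw [finRotate_last] at hr0
  have hrs : ∀ j : Fin (m + 1), MeasurableEquiv.piCongrLeft (fun _ : Fin (m + 2) => ℝ)
      (finRotate (m + 2)) y j.succ = y j.castSucc := fun j => by
    rw [← hr, finRotate_apply, Fin.coeSucc_eq_succ]
  have hrl := hrs (Fin.last m)
  rw [Fin.succ_last] at hrl
  simp only [Function.comp_apply]
  induction i using Fin.cases with
  | zero =>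
    rw [inverseBranch_zero]
    simp [hr0, hrl, hne.symm]
  | succ i =>
    induction i using Fin.lastCases with
    | last =>
      rw [Fin.succ_last]
      simp [hr0, hrl, hne, hne.symm]
    | cast i =>
      have h2 : (i.castSucc).succ ≠ Fin.last (m + 1) := by
        rw [← Fin.succ_last]
        simp
      rw [inverseBranch_succ_castSucc, Function.update_of_ne (Fin.succ_ne_zero _),
        Function.update_of_ne h2, hrs]

theorem measurePreserving_inverseWord (w : List ℕ) :
    MeasurePreserving (inverseWord w : (Fin (m + 2) → ℝ) → _) := by
  induction w with
  | nil => exact MeasurePreserving.id _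
  | cons b w ih => exact (measurePreserving_inverseBranch b).comp ih

theorem continuous_inverseBranch (b : ℕ) :
    Continuous (inverseBranch b : (Fin (m + 2) → ℝ) → _) := by
  refine continuous_pi fun i => ?_
  induction i using Fin.cases with
  | zero => simp only [inverseBranch_zero]; fun_prop
  | succ i =>
    induction i using Fin.lastCases with
    | last => simp only [Fin.succ_last, inverseBranch_last]; fun_prop
    | cast i => simp only [inverseBranch_succ_castSucc]; fun_prop

theorem measurableEmbedding_inverseBranch (b : ℕ) :
    MeasurableEmbedding (inverseBranch b : (Fin (m + 2) → ℝ) → _) :=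
  (continuous_inverseBranch b).measurableEmbedding (inverseBranch_injective b)

theorem continuous_inverseWord (w : List ℕ) :
    Continuous (inverseWord w : (Fin (m + 2) → ℝ) → _) := by
  induction w with
  | nil => exact continuous_id
  | cons b w ih => exact (continuous_inverseBranch b).comp ih

theorem measurableEmbedding_inverseWord (w : List ℕ) :
    MeasurableEmbedding (inverseWord w : (Fin (m + 2) → ℝ) → _) :=
  (continuous_inverseWord w).measurableEmbedding (inverseWord_injective w)

theorem volume_image_inverseBranch (b : ℕ) (s : Set (Fin (m + 2) → ℝ)) :
    volume (inverseBranch b '' s) = volume s := by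
  rw [← (measurePreserving_inverseBranch b).measure_preimage_emb
    (measurableEmbedding_inverseBranch b), preimage_image_eq _ (inverseBranch_injective b)]

theorem volume_image_inverseWord (w : List ℕ) (s : Set (Fin (m + 2) → ℝ)) :
    volume (inverseWord w '' s) = volume s := by
  rw [← (measurePreserving_inverseWord w).measure_preimage_emb
    (measurableEmbedding_inverseWord w), preimage_image_eq _ (inverseWord_injective w)]

theorem measurableSet_orthant : MeasurableSet (orthant m) := by
  simp only [orthant, ofPred_forall]
  exact MeasurableSet.iInter fun i => measurableSet_lt measurable_const (measurable_pi_apply i)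

theorem measurableSet_cylinder (w : List ℕ) : MeasurableSet (cylinder m w) :=
  (measurableEmbedding_inverseWord w).measurableSet_image.2 measurableSet_orthant

/-! ### Volumes of corners and the probability of tame digits -/

/-- The part of the positive orthant below the hyperplane `q ⬝ᵥ y = 1`. -/
def corner (q : Fin (m + 2) → ℝ) : Set (Fin (m + 2) → ℝ) := {y | y ∈ orthant m ∧ q ⬝ᵥ y < 1}

theorem measurableSet_corner (q : Fin (m + 2) → ℝ) : MeasurableSet (corner q) := by
  have h : Measurable fun y : Fin (m + 2) → ℝ => ∑ i, q i * y i := by fun_prop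
  exact measurableSet_orthant.inter (measurableSet_lt h measurable_const)

theorem inverseBranch_mem_corner {q y : Fin (m + 2) → ℝ} (hy : y ∈ orthant m) {b : ℕ} :
    inverseBranch b y ∈ corner q ↔ y ∈ corner (weightStep q b) := by
  simp [corner, hy, inverseBranch_mem_orthant hy b, dotProduct_inverseBranch]

theorem inverseWord_mem_corner {q y : Fin (m + 2) → ℝ} (hy : y ∈ orthant m) {w : List ℕ} :
    inverseWord w y ∈ corner q ↔ y ∈ corner (weightWord q w) := by
  simp [corner, hy, inverseWord_mem_orthant hy w, dotProduct_inverseWord]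

theorem volume_corner_lt_top {q : Fin (m + 2) → ℝ} (hq : q ∈ orthant m) :
    volume (corner q) < ∞ := by
  refine (measure_mono (t := Icc 0 q⁻¹) ?_).trans_lt isCompact_Icc.measure_lt_top
  rintro y ⟨hy, h⟩
  refine ⟨fun i => (hy i).le, fun i => ?_⟩
  have h1 : q i * y i ≤ q ⬝ᵥ y :=
    Finset.single_le_sum (f := fun i => q i * y i) (fun j _ => (mul_pos (hq j) (hy j)).le)
      (Finset.mem_univ i)
  rw [Pi.inv_apply, ← one_div, le_div_iff₀ (hq i)]
  linarith

theorem ae_ne_mul_last (c : ℝ) : ∀ᵐ y : Fin (m + 2) → ℝ, y 0 ≠ c * y (Fin.last _) := by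
  have hne : (0 : Fin (m + 2)) ≠ Fin.last (m + 1) := Fin.last_pos.ne
  have h : ∀ᵐ y : Fin (m + 2) → ℝ, y 0 ≠ 0 := Measure.ae_eval_ne _ _ _
  filter_upwards [(measurePreserving_shear hne (-c)).quasiMeasurePreserving.ae h] with y hy h'
  exact hy (by simp [h'])

theorem ae_exists_inverseBranch_eq :
    ∀ᵐ y, y ∈ orthant m → ∃ b, ∃ z ∈ orthant m, inverseBranch b z = y := by
  filter_upwards [ae_all_iff.2 fun b : ℕ => ae_ne_mul_last (m := m) b] with y h hy
  exact exists_inverseBranch_eq hy h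

/-- The volume of a part of a corner is the sum over its pieces. -/
theorem volume_corner_inter (q : Fin (m + 2) → ℝ) {s : Set (Fin (m + 2) → ℝ)}
    (hs : MeasurableSet s) :
    volume (corner q ∩ s) = ∑' b, volume (corner (weightStep q b) ∩ inverseBranch b ⁻¹' s) := by
  have h1 : (corner q ∩ s : Set (Fin (m + 2) → ℝ)) =ᵐ[volume]
      (⋃ b, inverseBranch b '' (corner (weightStep q b) ∩ inverseBranch b ⁻¹' s) :
        Set (Fin (m + 2) → ℝ)) := by
    refine Filter.eventuallyEq_set.2 ?_
    filter_upwards [ae_exists_inverseBranch_eq (m := m)] with y hy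
    refine ⟨fun h => ?_, fun h => ?_⟩
    · obtain ⟨b, z, hz, rfl⟩ := hy h.1.1
      exact mem_iUnion.2 ⟨b, z, ⟨(inverseBranch_mem_corner hz).1 h.1, h.2⟩, rfl⟩
    · obtain ⟨b, z, hz, rfl⟩ := mem_iUnion.1 h
      exact ⟨(inverseBranch_mem_corner hz.1.1).2 hz.1, hz.2⟩
  rw [measure_congr h1, measure_iUnion]
  · simp_rw [volume_image_inverseBranch]
  · intro b c hbc
    rw [Function.onFun, Set.disjoint_left]
    rintro _ ⟨y, hy, rfl⟩ ⟨z, hz, h⟩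
    exact hbc ((inverseBranch_eq_iff hz.1.1 hy.1.1).1 h).1.symm
  · intro b
    exact (measurableEmbedding_inverseBranch b).measurableSet_image.2
      ((measurableSet_corner _).inter ((continuous_inverseBranch b).measurable hs))

/-- Multiplying the last coordinate by `t` carries the corner on the left onto `corner q`. -/
theorem volume_corner_update_last (q : Fin (m + 2) → ℝ) {t : ℝ}
    (ht : 0 < t) :
    volume (corner (Function.update q (Fin.last _) (t * q (Fin.last _)))) =
      ENNReal.ofReal t⁻¹ * volume (corner q) := by
  set D : Fin (m + 2) → ℝ := Function.update 1 (Fin.last _) t with hD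
  have hdet : det (diagonal D) = t := by
    rw [det_diagonal, Fin.prod_univ_castSucc]
    simp [hD, (Fin.castSucc_lt_last _).ne]
  have h := Real.map_matrix_volume_pi_eq_smul_volume_pi (M := diagonal D) (hdet ▸ ht.ne')
  have h2 := congrArg (fun μ => μ (corner q)) h
  simp only [Measure.smul_apply, smul_eq_mul, hdet] at h2
  rw [Measure.map_apply (LinearMap.continuous_of_finiteDimensional _).measurable
    (measurableSet_corner q), abs_of_pos (inv_pos.2 ht)] at h2
  rw [← h2]
  congr 1
  ext y
  have hDp : ∀ i, 0 < D i := fun i => by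
    rw [hD]
    rcases eq_or_ne i (Fin.last _) with rfl | hi
    · simpa using ht
    · simp [hi]
  have hmem : y ∈ orthant m ↔ D * y ∈ orthant m :=
    forall_congr' fun i => by simp [hDp i]
  have hdot : Function.update q (Fin.last _) (t * q (Fin.last _)) = fun i => q i * D i := by
    funext i
    rcases eq_or_ne i (Fin.last _) with rfl | hi
    · simp [hD, mul_comm]
    · simp [hD, hi]
  have hlin : toLin' (diagonal D) y = D * y := by
    funext i
    simp [mulVec_diagonal]
  rw [mem_preimage, hlin, corner, corner, mem_ofPred_eq, mem_ofPred_eq, hmem, hdot]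
  simp [dotProduct, mul_assoc]

/-- At least half of a corner consists of points with a tame digit. -/
theorem half_volume_corner_le {q : Fin (m + 2) → ℝ} (hq : q ∈ orthant m) {β : ℝ}
    (hβ : q (Fin.last _) ≤ β * q 0) :
    2⁻¹ * volume (corner q) ≤ volume (corner q ∩ {y | y 0 ≤ β * y (Fin.last _)}) := by
  have h0 := hq 0
  have hl := hq (Fin.last _)
  have hne : (0 : Fin (m + 2)) ≠ Fin.last (m + 1) := Fin.last_pos.ne
  have hβ0 : 0 < β := by
    by_contra! h
    nlinarith
  have hms : MeasurableSet {y : Fin (m + 2) → ℝ | y 0 ≤ β * y (Fin.last _)} :=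
    measurableSet_le (by fun_prop) (by fun_prop)
  have hbad : volume (corner q \ {y | y 0 ≤ β * y (Fin.last _)}) ≤ 2⁻¹ * volume (corner q) := by
    -- The preimage of the bad part under the shear adding `β` times the last coordinate to the
    -- first lies in the corner with last weight `q (Fin.last _) + β * q 0`. This weight is `t ≥ 2`
    -- times the old one, so the volume is at most halved.
    set t := 1 + β * q 0 / q (Fin.last _) with ht
    have ht2 : 2 ≤ t := by
      have : 1 ≤ β * q 0 / q (Fin.last _) := (one_le_div hl).2 hβ
      linarith
    have htl : t * q (Fin.last _) = q (Fin.last _) + β * q 0 := by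
      rw [ht]
      field_simp
    have h1 := (measurePreserving_shear hne β).measure_preimage
      ((measurableSet_corner q).diff hms).nullMeasurableSet
    rw [← h1]
    refine (measure_mono (t := corner (Function.update q (Fin.last _) (t * q (Fin.last _))))
      ?_).trans ?_
    · rintro y ⟨⟨hy, hy1⟩, hy2⟩
      have hs := fun i : Fin (m + 1) => hy i.succ
      have hyl : 0 < y (Fin.last _) := by simpa [hne.symm] using hs (Fin.last m)
      refine ⟨fun i => ?_, ?_⟩
      · induction i using Fin.cases with
        | zero => simpa [hne.symm] using hy2
        | succ i => simpa using hs i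
      · refine lt_of_eq_of_lt ?_ hy1
        rw [htl]
        simp only [dotProduct]
        rw [Fin.sum_univ_succ, Fin.sum_univ_castSucc]
        rw [Fin.sum_univ_succ, Fin.sum_univ_castSucc]
        have h3 : ∀ i : Fin m, (i.castSucc).succ ≠ Fin.last (m + 1) := fun i => by
          rw [← Fin.succ_last]
          simp
        simp [hne, hne.symm, h3]
        ring
    · rw [volume_corner_update_last q (by linarith)]
      gcongr
      rw [ENNReal.ofReal_le_iff_le_toReal (by simp)]
      simpa using inv_anti₀ two_pos ht2
  have hsum := measure_inter_add_sdiff (μ := volume) (corner q) hms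
  have hfin := (volume_corner_lt_top hq).ne
  rw [← ENNReal.add_le_add_iff_right (a := 2⁻¹ * volume (corner q))
    (ENNReal.mul_ne_top (by simp) hfin), ← add_mul, ENNReal.inv_two_add_inv_two, one_mul]
  conv_lhs => rw [← hsum]
  gcongr

/-! ### Almost every point has a tame block -/

/-- The points whose first `k` digits form a tame word. -/
def tameSet (q : Fin (m + 2) → ℝ) (k : ℕ) : Set (Fin (m + 2) → ℝ) :=
  ⋃ u : {u : List ℕ // u.length = k ∧ IsTame q u}, cylinder m u

theorem measurableSet_tameSet (q : Fin (m + 2) → ℝ) (k : ℕ) : MeasurableSet (tameSet q k) :=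
  MeasurableSet.iUnion fun _ => measurableSet_cylinder _

theorem tameSet_zero (q : Fin (m + 2) → ℝ) : tameSet q 0 = orthant m := by
  have h : cylinder m [] = orthant m := image_id _
  refine Subset.antisymm (iUnion_subset fun u => cylinder_subset_orthant _) ?_
  rw [← h]
  exact subset_iUnion_of_subset (⟨[], rfl, trivial⟩ : {u : List ℕ // u.length = 0 ∧ IsTame q u})
    Subset.rfl

theorem inverseBranch_mem_tameSet {q y : Fin (m + 2) → ℝ} (hy : y ∈ orthant m) {b k : ℕ} :
    inverseBranch b y ∈ tameSet q (k + 1) ↔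
      b * q 0 ≤ q (Fin.last _) ∧ y ∈ tameSet (weightStep q b) k := by
  simp only [tameSet, mem_iUnion, Subtype.exists, exists_prop]
  constructor
  · rintro ⟨u, ⟨hl, ht⟩, hu⟩
    cases u with
    | nil => simp at hl
    | cons c u =>
      obtain ⟨rfl, hyu⟩ := (inverseBranch_mem_cylinder_cons hy).1 hu
      exact ⟨ht.1, u, ⟨by simpa using hl, ht.2⟩, hyu⟩
  · rintro ⟨hb, u, ⟨hl, ht⟩, hu⟩
    exact ⟨b :: u, ⟨by simpa using hl, hb, ht⟩, (inverseBranch_mem_cylinder_cons hy).2 ⟨rfl, hu⟩⟩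

theorem pow_mul_volume_corner_le {q : Fin (m + 2) → ℝ} (hq : q ∈ orthant m) (k : ℕ) :
    (2⁻¹ : ℝ≥0∞) ^ k * volume (corner q) ≤ volume (corner q ∩ tameSet q k) := by
  induction k generalizing q with
  | zero =>
    rw [tameSet_zero, inter_eq_left.2 fun y hy => hy.1]
    simp
  | succ k ih =>
    -- With this integer `β`, points with `y 0 ≤ β * y (Fin.last _)` have digit less than `β`, that
    -- is, a tame one.
    set β : ℕ := ⌊q (Fin.last _) / q 0⌋₊ + 1 with hβ
    have hβ1 : q (Fin.last _) ≤ (β : ℝ) * q 0 := by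
      rw [← div_le_iff₀ (hq 0), hβ]
      exact_mod_cast (Nat.lt_floor_add_one _).le
    have h := half_volume_corner_le hq hβ1
    rw [pow_succ, mul_assoc]
    refine (mul_le_mul_right h _).trans ?_
    rw [volume_corner_inter q (measurableSet_le (by fun_prop) (by fun_prop)),
      volume_corner_inter q (measurableSet_tameSet q _), ← ENNReal.tsum_mul_left]
    refine ENNReal.tsum_le_tsum fun b => ?_
    by_cases hb : b * q 0 ≤ q (Fin.last _)
    · refine (mul_le_mul_right (measure_mono inter_subset_left) _).trans
        ((ih (weightStep_mem_orthant hq b)).trans (measure_mono fun y hy => ⟨hy.1, ?_⟩))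
      exact (inverseBranch_mem_tameSet hy.1.1).2 ⟨hb, hy.2⟩
    · suffices hE : corner (weightStep q b) ∩
          inverseBranch b ⁻¹' {y | y 0 ≤ β * y (Fin.last _)} = ∅ by
        rw [hE]
        simp
      refine eq_empty_of_forall_notMem fun y hy => hb ?_
      have h1 := (inverseBranch_mul_last_lt hy.1.1 b).1.trans_le hy.2
      have h2 : (b : ℝ) < β :=
        lt_of_mul_lt_mul_right h1 (inverseBranch_mem_orthant hy.1.1 b _).le
      have h3 : b ≤ ⌊q (Fin.last _) / q 0⌋₊ := by
        rw [hβ] at h2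
        exact Nat.lt_succ_iff.1 (by exact_mod_cast h2)
      rw [← le_div_iff₀ (hq 0)]
      exact (Nat.cast_le.2 h3).trans (Nat.floor_le (div_nonneg (hq _).le (hq 0).le))

/-- The points with a tame word of length `m + 1` among their digits. -/
def tamePoints (q : Fin (m + 2) → ℝ) : Set (Fin (m + 2) → ℝ) :=
  ⋃ v : List ℕ, ⋃ u : {u : List ℕ // u.length = m + 1 ∧ IsTame (weightWord q v) u},
    cylinder m (v ++ u)

theorem mem_tamePoints {q y : Fin (m + 2) → ℝ} : y ∈ tamePoints q ↔
    ∃ v u, u.length = m + 1 ∧ IsTame (weightWord q v) u ∧ y ∈ cylinder m (v ++ u) := by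
  simp [tamePoints, and_assoc]

theorem measurableSet_tamePoints (q : Fin (m + 2) → ℝ) : MeasurableSet (tamePoints q) :=
  MeasurableSet.iUnion fun _ => MeasurableSet.iUnion fun _ => measurableSet_cylinder _

theorem tameSet_subset_tamePoints (q : Fin (m + 2) → ℝ) :
    tameSet q (m + 1) ⊆ tamePoints q :=
  subset_iUnion_of_subset [] Subset.rfl

theorem inverseBranch_mem_tamePoints {q y : Fin (m + 2) → ℝ} {b : ℕ}
    (h : y ∈ tamePoints (weightStep q b)) : inverseBranch b y ∈ tamePoints q := by
  rw [mem_tamePoints] at h ⊢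
  obtain ⟨v, u, hl, ht, hy⟩ := h
  refine ⟨b :: v, u, hl, ht, ?_⟩
  rw [List.cons_append, cylinder_cons]
  exact mem_image_of_mem _ hy

/-- A restart argument: at the first digit that is not tame, the remaining digits see a new corner,
to which the uniform bound `hg` applies. Using this bound only outside `tameSet q k` is what allows
it to be improved. -/
theorem volume_corner_diff_tamePoints_le {g : ℝ≥0∞}
    (hg : ∀ q : Fin (m + 2) → ℝ, q ∈ orthant m →
      volume (corner q \ tamePoints q) ≤ g * volume (corner q))
    {q : Fin (m + 2) → ℝ} (hq : q ∈ orthant m) (k : ℕ) :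
    volume (corner q ∩ ((tamePoints q)ᶜ \ tameSet q k)) ≤
      g * volume (corner q ∩ (tameSet q k)ᶜ) := by
  induction k generalizing q with
  | zero =>
    rw [tameSet_zero]
    have : corner q ∩ ((tamePoints q)ᶜ \ orthant m) = ∅ :=
      eq_empty_of_forall_notMem fun y hy => hy.2.2 hy.1.1
    simp [this]
  | succ k ih =>
    rw [volume_corner_inter q ((measurableSet_tamePoints q).compl.diff (measurableSet_tameSet q _)),
      volume_corner_inter q (measurableSet_tameSet q _).compl, ← ENNReal.tsum_mul_left]
    refine ENNReal.tsum_le_tsum fun b => ?_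
    have hqb := weightStep_mem_orthant hq b
    by_cases hb : b * q 0 ≤ q (Fin.last _)
    · refine (measure_mono ?_).trans ((ih hqb).trans (mul_le_mul_right (measure_mono ?_) _))
      · intro y hy
        exact ⟨hy.1, fun h => hy.2.1 (inverseBranch_mem_tamePoints h),
          fun h => hy.2.2 ((inverseBranch_mem_tameSet hy.1.1).2 ⟨hb, h⟩)⟩
      · intro y hy
        exact ⟨hy.1, fun h => hy.2 ((inverseBranch_mem_tameSet hy.1.1).1 h).2⟩
    · refine (measure_mono ?_).trans ((hg _ hqb).trans (mul_le_mul_right (measure_mono ?_) _))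
      · intro y hy
        exact ⟨hy.1, fun h => hy.2.1 (inverseBranch_mem_tamePoints h)⟩
      · intro y hy
        exact ⟨hy, fun h => hb ((inverseBranch_mem_tameSet hy.1).1 h).1⟩

/-- Each restart gains the factor `1 - 2⁻¹ ^ (m + 1)`, a bound for the proportion of points whose
first `m + 1` digits are not all tame. -/
theorem volume_corner_diff_tamePoints_le_pow {q : Fin (m + 2) → ℝ} (hq : q ∈ orthant m) (j : ℕ) :
    volume (corner q \ tamePoints q) ≤
      (1 - (2⁻¹ : ℝ≥0∞) ^ (m + 1)) ^ j * volume (corner q) := by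
  induction j generalizing q with
  | zero => simpa using measure_mono sdiff_subset
  | succ j ih =>
    have h := volume_corner_diff_tamePoints_le (fun q hq => ih hq) hq (m + 1)
    rw [sdiff_eq_left.2 (disjoint_compl_left.mono_right (tameSet_subset_tamePoints q))] at h
    rw [sdiff_eq]
    refine h.trans ?_
    rw [pow_succ (1 - (2⁻¹ : ℝ≥0∞) ^ (m + 1)), mul_assoc]
    gcongr
    rw [← sdiff_eq, ENNReal.sub_mul fun _ _ => (volume_corner_lt_top hq).ne, one_mul]
    have h1 := measure_inter_add_sdiff (μ := volume) (corner q) (measurableSet_tameSet q (m + 1))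
    refine ENNReal.le_sub_of_add_le_left ?_ ?_
    · exact ENNReal.mul_ne_top (by simp) (volume_corner_lt_top hq).ne
    · rw [← h1]
      gcongr
      rw [h1]
      exact pow_mul_volume_corner_le hq _

/-- Almost every point has a tame word of length `m + 1` among its digits. -/
theorem volume_corner_diff_tamePoints {q : Fin (m + 2) → ℝ} (hq : q ∈ orthant m) :
    volume (corner q \ tamePoints q) = 0 := by
  have h1 : (1 - (2⁻¹ : ℝ≥0∞) ^ (m + 1)) < 1 :=
    ENNReal.sub_lt_self (by simp) (by simp) (by simp)
  have h2 := ENNReal.Tendsto.mul_const (ENNReal.tendsto_pow_atTop_nhds_zero_of_lt_one h1)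
    (b := volume (corner q)) (Or.inr (volume_corner_lt_top hq).ne)
  rw [zero_mul] at h2
  exact nonpos_iff_eq_zero.1
    (ge_of_tendsto' h2 fun j => volume_corner_diff_tamePoints_le_pow hq j)


/-! ### Narrow balanced cylinders -/

/-- On the cylinder of the word, each coordinate of a point divided by the sum of its coordinates
lies in a fixed interval of length `ε`. -/
def IsPinched (m : ℕ) (ε : ℝ) (w : List ℕ) : Prop :=
  ∀ l : Fin (m + 2), ∃ a b : ℝ, a ≤ b ∧ b - a ≤ ε ∧
    (∀ i, a * weightWord 1 w i ≤ weightWord (Pi.single l 1) w i) ∧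
    ∀ i, weightWord (Pi.single l 1) w i ≤ b * weightWord 1 w i

/-- The entries of the weight of the word are comparable. -/
def IsBalanced (m : ℕ) (w : List ℕ) : Prop :=
  ∃ t : ℝ, 0 < t ∧ ∀ i : Fin (m + 2), t ≤ weightWord 1 w i ∧ weightWord 1 w i ≤ 3 ^ (m + 1) * t

theorem one_mem_orthant : (1 : Fin (m + 2) → ℝ) ∈ orthant m := fun _ => one_pos

theorem maxLast_one : MaxLast (1 : Fin (m + 2) → ℝ) := fun _ => le_rfl

theorem isPinched_nil : IsPinched m 1 [] := by
  refine fun l => ⟨0, 1, zero_le_one, by simp, fun i => ?_, fun i => ?_⟩ <;>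
  · rcases eq_or_ne i l with rfl | h <;> simp [weightWord, *]

theorem IsPinched.append {ε : ℝ} {w : List ℕ} (h : IsPinched m ε w) (v : List ℕ) :
    IsPinched m ε (w ++ v) := by
  intro l
  obtain ⟨a, b, hab, hε, ha, hb⟩ := h l
  simp only [weightWord_append]
  exact ⟨a, b, hab, hε, weightWord_mono ha v, weightWord_mono_right hb v⟩

theorem pinchRate_pos : 0 < pinchRate m := by
  have : (3 ^ (m + 1) : ℝ)⁻¹ ≤ 1 := inv_le_one_of_one_le₀ (one_le_pow₀ (by norm_num))
  rw [pinchRate]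
  linarith

theorem pinchRate_lt_one : pinchRate m < 1 := by
  have : 0 < (3 ^ (m + 1) : ℝ)⁻¹ := by positivity
  rw [pinchRate]
  linarith

theorem IsPinched.append_of_isTame {ε : ℝ} {w u : List ℕ} (h : IsPinched m ε w)
    (hl : u.length = m + 1) (hu : IsTame (weightWord (1 : Fin (m + 2) → ℝ) w) u) :
    IsPinched m (pinchRate m * ε) (w ++ u) := by
  intro l
  obtain ⟨a, b, hab, hε, ha, hb⟩ := h l
  obtain ⟨a', b', hab', h', ha', hb'⟩ := hu.exists_pinch (weightWord_mem_orthant one_mem_orthant w)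
    (maxLast_one.weightWord one_mem_orthant w) hl hab ha hb
  simp only [weightWord_append]
  exact ⟨a', b', hab', h'.trans (mul_le_mul_of_nonneg_left hε pinchRate_pos.le), ha', hb'⟩

theorem isBalanced_append {w u : List ℕ} (hl : u.length = m + 1)
    (hu : IsTame (weightWord (1 : Fin (m + 2) → ℝ) w) u) : IsBalanced m (w ++ u) := by
  have hq := weightWord_mem_orthant (one_mem_orthant (m := m)) w
  have hm := maxLast_one.weightWord (one_mem_orthant (m := m)) w
  refine ⟨_, hq (Fin.last _), fun i => ?_⟩
  have h := (hm.weightWord hq u i).trans (hu.weightWord_last_le hq hm)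
  rw [hl] at h
  rw [weightWord_append]
  exact ⟨last_le_weightWord (fun i => (hq i).le) hl i, h⟩

/-- Almost every point lies in a balanced cylinder which is as narrow as one likes. -/
theorem volume_corner_diff_iUnion_cylinder (j : ℕ) :
    volume (corner 1 \ ⋃ w ∈ {w | IsPinched m (pinchRate m ^ j) w ∧ IsBalanced m w},
      cylinder m w) = 0 := by
  induction j with
  | zero =>
    suffices h : (corner 1 \ ⋃ w ∈ {w | IsPinched m (pinchRate m ^ 0) w ∧ IsBalanced m w},
        cylinder m w) = ∅ by
      rw [h, measure_empty]
    refine sdiff_eq_empty.2 fun y hy =>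
      mem_iUnion₂.2 ⟨[], ⟨?_, 1, one_pos, fun i => ?_⟩, y, hy.1, rfl⟩
    · simpa using isPinched_nil
    · simpa [weightWord] using one_le_pow₀ (by norm_num : (1 : ℝ) ≤ 3)
  | succ j ih =>
    -- The exceptional points are those missed at stage `j` and, for each of the countably many
    -- words `w`, those of its cylinder with no tame block after `w`.
    refine measure_mono_null (t := (corner 1 \ ⋃ w ∈ {w | IsPinched m (pinchRate m ^ j) w ∧
      IsBalanced m w}, cylinder m w) ∪ ⋃ w, inverseWord w ''
        (corner (weightWord 1 w) \ tamePoints (weightWord 1 w))) ?_ ?_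
    · rintro y ⟨hy, hy'⟩
      by_contra! hc
      rw [mem_union, not_or, mem_sdiff, not_and_not_right] at hc
      obtain ⟨w, hw, z, hz, rfl⟩ := mem_iUnion₂.1 (hc.1 hy)
      have hzt : z ∈ tamePoints (weightWord 1 w) := by
        by_contra hzt
        exact hc.2 (mem_iUnion.2 ⟨w, z, ⟨(inverseWord_mem_corner hz).1 hy, hzt⟩, rfl⟩)
      obtain ⟨v, u, hl, hu, x, hx, rfl⟩ := mem_tamePoints.1 hzt
      rw [← weightWord_append] at hu
      refine hy' (mem_iUnion₂.2 ⟨w ++ v ++ u, ⟨?_, isBalanced_append hl hu⟩, x, hx, ?_⟩)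
      · rw [pow_succ']
        exact (hw.1.append v).append_of_isTame hl hu
      · rw [List.append_assoc, inverseWord_append w]
    · refine measure_union_null ih (measure_iUnion_null fun w => ?_)
      rw [volume_image_inverseWord]
      exact volume_corner_diff_tamePoints (weightWord_mem_orthant one_mem_orthant w)

/-- Any union of cylinders is a disjoint union of some of them. -/
theorem exists_pairwise_disjoint_cylinder (m : ℕ) (G : Set (List ℕ)) :
    ∃ G' ⊆ G, G'.PairwiseDisjoint (cylinder m) ∧
      ⋃ w ∈ G', cylinder m w = ⋃ w ∈ G, cylinder m w := by
  have hsub : {w ∈ G | ∀ v ∈ G, v <+: w → v = w} ⊆ G := sep_subset _ _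
  refine ⟨{w ∈ G | ∀ v ∈ G, v <+: w → v = w}, hsub, ?_, ?_⟩
  · intro v hv w hw hvw
    rw [Function.onFun, Set.disjoint_left]
    intro y hyv hyw
    rcases prefix_or_prefix_of_mem_cylinder hyv hyw with h | h
    · exact hvw (hw.2 v hv.1 h)
    · exact hvw (hv.2 w hw.1 h).symm
  · refine Subset.antisymm (biUnion_subset_biUnion_left hsub) (iUnion₂_subset fun w hw => ?_)
    have hex : ∃ n, ∃ v ∈ G, v <+: w ∧ v.length = n := ⟨_, w, hw, List.prefix_rfl, rfl⟩
    classical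
    obtain ⟨v, hv, hvw, hlen⟩ := Nat.find_spec hex
    refine subset_iUnion₂_of_subset v ⟨hv, fun u hu huv => ?_⟩ ?_
    · refine huv.eq_of_length (le_antisymm huv.length_le ?_)
      rw [hlen]
      exact Nat.find_min' hex ⟨u, hu, huv.trans hvw, rfl⟩
    · obtain ⟨u, rfl⟩ := hvw
      exact cylinder_append_subset v u

/-- The projection onto the hyperplane where the sum of the coordinates is one. -/
noncomputable def normalize (y : Fin (m + 2) → ℝ) : Fin (m + 2) → ℝ := (∑ i, y i)⁻¹ • y

theorem measurable_normalize : Measurable (normalize : (Fin (m + 2) → ℝ) → _) := by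
  unfold normalize
  fun_prop

theorem sum_pos_of_mem_orthant {y : Fin (m + 2) → ℝ} (hy : y ∈ orthant m) : 0 < ∑ i, y i :=
  Finset.sum_pos (fun i _ => hy i) Finset.univ_nonempty

/-- Coordinate `l` and the coordinate sum of `inverseWord w y` are combinations of the entries of
two weights with the same positive coefficients `y i`. Their quotient lies between the bounds for
the entrywise ratios. -/
theorem IsPinched.abs_normalize_sub_le {ε : ℝ} {w : List ℕ} (h : IsPinched m ε w)
    {y z : Fin (m + 2) → ℝ} (hy : y ∈ cylinder m w) (hz : z ∈ cylinder m w) (l : Fin (m + 2)) :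
    |normalize y l - normalize z l| ≤ ε := by
  obtain ⟨a, b, hab, hε, ha, hb⟩ := h l
  have key : ∀ y ∈ cylinder m w, a ≤ normalize y l ∧ normalize y l ≤ b := by
    rintro _ ⟨y, hy, rfl⟩
    have hs := sum_pos_of_mem_orthant (inverseWord_mem_orthant hy w)
    have h1 : inverseWord w y l = ∑ i, weightWord (Pi.single l 1) w i * y i := by
      rw [← single_one_dotProduct l (inverseWord w y), dotProduct_inverseWord]
      rfl
    have h2 : ∑ i, inverseWord w y i = ∑ i, weightWord 1 w i * y i := by
      rw [← one_dotProduct, dotProduct_inverseWord]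
      rfl
    rw [normalize, Pi.smul_apply, smul_eq_mul, inv_mul_eq_div, le_div_iff₀ hs, div_le_iff₀ hs, h1,
      h2, Finset.mul_sum, Finset.mul_sum]
    constructor <;> refine Finset.sum_le_sum fun i _ => ?_ <;> rw [← mul_assoc]
    · exact mul_le_mul_of_nonneg_right (ha i) (hy i).le
    · exact mul_le_mul_of_nonneg_right (hb i) (hy i).le
  have h1 := key y hy
  have h2 := key z hz
  rw [abs_le]
  constructor <;> linarith

/-! ### Zero-one law for invariant cones -/

/-- A set that is a union of open rays from the origin. -/
def IsConic (A : Set (Fin (m + 2) → ℝ)) : Prop :=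
  ∀ t : ℝ, 0 < t → ∀ y ∈ A, t • y ∈ A

theorem IsConic.smul_mem_iff {A : Set (Fin (m + 2) → ℝ)} (hA : IsConic A) {t : ℝ} (ht : 0 < t)
    {y : Fin (m + 2) → ℝ} : t • y ∈ A ↔ y ∈ A := by
  refine ⟨fun h => ?_, hA t ht y⟩
  simpa [smul_smul, ht.ne'] using hA t⁻¹ (inv_pos.2 ht) _ h

theorem inverseWord_mem_iff {A : Set (Fin (m + 2) → ℝ)}
    (hA : ∀ b, ∀ y ∈ orthant m, inverseBranch b y ∈ A ↔ y ∈ A) {y : Fin (m + 2) → ℝ}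
    (hy : y ∈ orthant m) (w : List ℕ) : inverseWord w y ∈ A ↔ y ∈ A := by
  induction w with
  | nil => rfl
  | cons b w ih => exact (hA b _ (inverseWord_mem_orthant hy w)).trans ih

/-- An invariant cone has a definite proportion in every balanced cylinder. -/
theorem IsBalanced.mul_volume_le {w : List ℕ} (hw : IsBalanced m w) {A : Set (Fin (m + 2) → ℝ)}
    (hc : IsConic A) (hA : ∀ b, ∀ y ∈ orthant m, inverseBranch b y ∈ A ↔ y ∈ A) :
    volume (corner 1 ∩ A) * volume (corner 1 ∩ cylinder m w) ≤
      ENNReal.ofReal ((3 ^ (m + 1)) ^ (m + 2)) * volume (corner (1 : Fin (m + 2) → ℝ)) *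
        volume (corner 1 ∩ A ∩ cylinder m w) := by
  obtain ⟨t, ht, h⟩ := hw
  set q : Fin (m + 2) → ℝ := weightWord 1 w with hq
  set C : ℝ := 3 ^ (m + 1) with hC
  have hC0 : 0 < C := by positivity
  -- Inside the cylinder `corner 1` becomes `corner q`. The bounds `t ≤ q i ≤ C * t` place it
  -- between the dilates of `corner 1` by `(C * t)⁻¹` and `t⁻¹`, and `A` is unaffected by dilations
  -- and by `inverseWord w`.
  have h1 : volume (corner 1 ∩ cylinder m w) ≤
      ENNReal.ofReal (t⁻¹ ^ (m + 2)) * volume (corner (1 : Fin (m + 2) → ℝ)) := by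
    have hsub : corner 1 ∩ cylinder m w ⊆ inverseWord w '' (t⁻¹ • corner 1) := by
      rintro _ ⟨hy, y, hyo, rfl⟩
      refine mem_image_of_mem _ ((mem_inv_smul_set_iff₀ ht.ne' _ _).2 ⟨fun i => ?_, ?_⟩)
      · exact mul_pos ht (hyo i)
      · refine lt_of_le_of_lt ?_ ((inverseWord_mem_corner hyo).1 hy).2
        rw [one_dotProduct]
        exact Finset.sum_le_sum fun i _ => mul_le_mul_of_nonneg_right (h i).1 (hyo i).le
    refine (measure_mono hsub).trans ?_
    rw [volume_image_inverseWord, Measure.addHaar_smul, Module.finrank_fintype_fun_eq_card,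
      Fintype.card_fin, abs_of_pos (by positivity)]
  have h2 : ENNReal.ofReal ((C * t)⁻¹ ^ (m + 2)) * volume (corner 1 ∩ A) ≤
      volume (corner 1 ∩ A ∩ cylinder m w) := by
    have hsub : inverseWord w '' ((C * t)⁻¹ • (corner 1 ∩ A)) ⊆ corner 1 ∩ A ∩ cylinder m w := by
      rintro _ ⟨y, hy, rfl⟩
      rw [mem_inv_smul_set_iff₀ (by positivity)] at hy
      have hyo : y ∈ orthant m := fun i => by
        have := hy.1.1 i
        rw [Pi.smul_apply, smul_eq_mul] at this
        exact pos_of_mul_pos_right this (by positivity)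
      refine ⟨⟨(inverseWord_mem_corner hyo).2 ⟨hyo, ?_⟩, ?_⟩, y, hyo, rfl⟩
      · refine lt_of_le_of_lt ?_ hy.1.2
        rw [one_dotProduct]
        exact Finset.sum_le_sum fun i _ => mul_le_mul_of_nonneg_right (h i).2 (hyo i).le
      · exact (inverseWord_mem_iff hA hyo w).2 ((hc.smul_mem_iff (by positivity)).1 hy.2)
    refine le_trans ?_ (measure_mono hsub)
    rw [volume_image_inverseWord, Measure.addHaar_smul, Module.finrank_fintype_fun_eq_card,
      Fintype.card_fin, abs_of_pos (by positivity)]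
  refine (mul_le_mul_right h1 _).trans (le_trans (le_of_eq ?_) (mul_le_mul_right h2 _))
  have h3 : t⁻¹ ^ (m + 2) = C ^ (m + 2) * (C * t)⁻¹ ^ (m + 2) := by
    rw [← mul_pow]
    congr 1
    field_simp
  rw [h3, ENNReal.ofReal_mul (by positivity)]
  ring

theorem mul_volume_iUnion_cylinder_le {A S : Set (Fin (m + 2) → ℝ)} (hA : MeasurableSet A)
    (hS : MeasurableSet S) {a K : ℝ≥0∞} {G : Set (List ℕ)}
    (h : ∀ w ∈ G, a * volume (S ∩ cylinder m w) ≤ K * volume (S ∩ A ∩ cylinder m w)) :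
    a * volume (S ∩ ⋃ w ∈ G, cylinder m w) ≤ K * volume (S ∩ A ∩ ⋃ w ∈ G, cylinder m w) := by
  obtain ⟨G', hG', hd, hU⟩ := exists_pairwise_disjoint_cylinder m G
  have key : ∀ R : Set (Fin (m + 2) → ℝ), MeasurableSet R →
      volume (R ∩ ⋃ w ∈ G', cylinder m w) = ∑' w : G', volume (R ∩ cylinder m w) := by
    intro R hR
    rw [inter_iUnion₂, measure_biUnion (to_countable G')
      (hd.mono fun w => inter_subset_right) fun w _ => hR.inter (measurableSet_cylinder w)]
  rw [← hU, key S hS, key _ (hS.inter hA), ← ENNReal.tsum_mul_left, ← ENNReal.tsum_mul_left]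
  exact ENNReal.tsum_le_tsum fun w => h w (hG' w.2)

/-- A measurable cone which is invariant under the homogeneous triangle map is null or conull. -/
theorem volume_corner_inter_eq_zero_or {A : Set (Fin (m + 2) → ℝ)} (hm : MeasurableSet A)
    (hc : IsConic A) (hA : ∀ b, ∀ y ∈ orthant m, inverseBranch b y ∈ A ↔ y ∈ A) :
    volume (corner 1 ∩ A) = 0 ∨ volume (corner 1 \ A) = 0 := by
  set ν := (volume.restrict (corner (1 : Fin (m + 2) → ℝ))).map normalize with hν
  have hfin : volume (corner (1 : Fin (m + 2) → ℝ)) ≠ ∞ := (volume_corner_lt_top one_mem_orthant).ne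
  have : IsFiniteMeasure (volume.restrict (corner (1 : Fin (m + 2) → ℝ))) :=
    isFiniteMeasure_restrict.2 hfin
  have hνs : ∀ s, MeasurableSet s → ν s = volume (normalize ⁻¹' s ∩ corner 1) := fun s hs => by
    rw [hν, Measure.map_apply measurable_normalize hs,
      Measure.restrict_apply (measurable_normalize hs)]
  have hnA : ∀ y ∈ orthant m, normalize y ∈ A ↔ y ∈ A := fun y hy =>
    hc.smul_mem_iff (inv_pos.2 (sum_pos_of_mem_orthant hy))
  set K := ENNReal.ofReal ((3 ^ (m + 1)) ^ (m + 2)) * volume (corner (1 : Fin (m + 2) → ℝ)) with hK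
  have hKfin : K ≠ ∞ := ENNReal.mul_ne_top ENNReal.ofReal_ne_top hfin
  suffices h : ∀ ε : ℝ≥0∞, ε ≠ 0 →
      volume (corner 1 ∩ A) * volume (corner 1 \ A) ≤ K * ε by
    rw [← mul_eq_zero, ← nonpos_iff_eq_zero]
    have hlim : Filter.Tendsto (fun ε : ℝ≥0∞ => K * ε) (nhdsWithin 0 {0}ᶜ) (nhds (K * 0)) :=
      (ENNReal.Tendsto.const_mul Filter.tendsto_id (Or.inr hKfin)).mono_left nhdsWithin_le_nhds
    rw [mul_zero] at hlim
    exact ge_of_tendsto hlim (Filter.eventually_of_mem self_mem_nhdsWithin fun ε hε => h ε hε)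
  intro ε hε
  -- Cylinders are narrow only after normalization, so outer regularity is used for the distribution
  -- `ν` of directions: `U` contains the complement of `A` and little of `A`.
  obtain ⟨U, hAU, hU, -, hUε⟩ := hm.compl.exists_isOpen_sdiff_lt (μ := ν) (measure_ne_top _ _) hε
  rw [sdiff_compl, hνs _ (hU.measurableSet.inter hm)] at hUε
  set G := {w | IsBalanced m w ∧ ∀ y ∈ cylinder m w, normalize y ∈ U} with hG
  have hcover : volume (corner 1 \ A) ≤ volume (corner 1 ∩ ⋃ w ∈ G, cylinder m w) := by
    refine measure_mono_ae ?_
    have hae := ae_all_iff.2 fun j : ℕ =>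
      measure_eq_zero_iff_ae_notMem.1 (volume_corner_diff_iUnion_cylinder (m := m) j)
    filter_upwards [hae] with y hy hyA
    have hyU : normalize y ∈ U := hAU fun h => hyA.2 ((hnA y hyA.1.1).1 h)
    obtain ⟨δ, hδ, hball⟩ := Metric.isOpen_iff.1 hU _ hyU
    obtain ⟨j, hj⟩ := exists_pow_lt_of_lt_one hδ (pinchRate_lt_one (m := m))
    have hyj := hy j
    rw [mem_sdiff, not_and_not_right] at hyj
    obtain ⟨w, hw, hyw⟩ := mem_iUnion₂.1 (hyj hyA.1)
    refine ⟨hyA.1, mem_iUnion₂.2 ⟨w, ⟨hw.2, fun z hz => hball ?_⟩, hyw⟩⟩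
    rw [Metric.mem_ball]
    refine lt_of_le_of_lt ((dist_pi_le_iff (pow_nonneg pinchRate_pos.le j)).2 fun l => ?_) hj
    exact hw.1.abs_normalize_sub_le hz hyw l
  refine (mul_le_mul_right hcover _).trans ((mul_volume_iUnion_cylinder_le hm
    (measurableSet_corner 1) fun w hw => hw.1.mul_volume_le hc hA).trans (mul_le_mul_right ?_ _))
  refine (measure_mono ?_).trans hUε.le
  rintro y ⟨hyA, hy⟩
  obtain ⟨w, hw, hyw⟩ := mem_iUnion₂.1 hy
  exact ⟨⟨hw.2 y hyw, (hnA y hyA.1.1).2 hyA.2⟩, hyA.1⟩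


/-! ### Conjugacy between the triangle map and the linear branches -/

/-- The linear change of coordinates `xᵢ = yᵢ + yᵢ₊₁ + ⋯`. -/
def tailSum (y : Fin (m + 2) → ℝ) (i : Fin (m + 2)) : ℝ := ∑ j ∈ Finset.Ici i, y j

theorem tailSum_last (y : Fin (m + 2) → ℝ) : tailSum y (Fin.last _) = y (Fin.last _) := by
  have : Finset.Ici (Fin.last (m + 1)) = {Fin.last _} := by
    ext i
    simp [Fin.last_le_iff]
  rw [tailSum, this, Finset.sum_singleton]

theorem tailSum_castSucc (y : Fin (m + 2) → ℝ) (i : Fin (m + 1)) :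
    tailSum y i.castSucc = y i.castSucc + tailSum y i.succ := by
  have : Finset.Ici i.castSucc = insert i.castSucc (Finset.Ici i.succ) := by
    ext j
    simp only [Finset.mem_Ici, Finset.mem_insert, Fin.le_def, Fin.ext_iff, Fin.val_castSucc,
      Fin.val_succ]
    omega
  rw [tailSum, this, Finset.sum_insert (by simp [Fin.le_def]), tailSum]

theorem tailSum_pos {y : Fin (m + 2) → ℝ} (hy : y ∈ orthant m) (i : Fin (m + 2)) :
    0 < tailSum y i :=
  Finset.sum_pos (fun j _ => hy j) ⟨i, by simp⟩

theorem measurePreserving_tailSum : MeasurePreserving (tailSum : (Fin (m + 2) → ℝ) → _) := by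
  set M : Matrix (Fin (m + 2)) (Fin (m + 2)) ℝ := of fun i j => if i ≤ j then 1 else 0 with hM
  have hdet : M.det = 1 := by
    rw [det_of_isUpperTriangular]
    · simp [hM]
    · intro i j (hij : j < i)
      simp [hM, hij.not_ge]
  have htoLin : (toLin' M : (Fin (m + 2) → ℝ) → _) = tailSum := by
    funext y i
    simp only [toLin'_apply, mulVec, dotProduct, hM, of_apply, ite_mul, one_mul, zero_mul, tailSum]
    rw [← Finset.sum_filter]
    congr 1
    ext j
    simp
  have h := Real.map_matrix_volume_pi_eq_smul_volume_pi (M := M) (by simp [hdet])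
  rw [hdet] at h
  rw [← htoLin]
  exact ⟨(LinearMap.continuous_of_finiteDimensional _).measurable, by simpa using h⟩

/-- The point of the simplex represented by a vector of homogeneous coordinates. -/
noncomputable def shape (y : Fin (m + 2) → ℝ) (i : Fin (m + 1)) : ℝ :=
  tailSum y i.succ / tailSum y 0

theorem measurable_shape : Measurable (shape : (Fin (m + 2) → ℝ) → _) := by
  unfold shape tailSum
  fun_prop

theorem shape_smul {t : ℝ} (ht : 0 < t) (y : Fin (m + 2) → ℝ) : shape (t • y) = shape y := by
  funext i
  simp only [shape, tailSum, Pi.smul_apply, smul_eq_mul, ← Finset.mul_sum]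
  exact mul_div_mul_left _ _ ht.ne'

theorem antitone_tailSum {y : Fin (m + 2) → ℝ} (hy : y ∈ orthant m) : Antitone (tailSum y) :=
  Fin.antitone_iff_succ_le.2 fun i => by
    rw [tailSum_castSucc]
    linarith [hy i.castSucc]

theorem shape_mem_simplex {y : Fin (m + 2) → ℝ} (hy : y ∈ orthant m) :
    shape y ∈ simplex (m + 1) := by
  have h0 := tailSum_pos hy 0
  refine ⟨fun i => (div_le_one h0).2 (antitone_tailSum hy (Fin.zero_le _)), fun i j hij => ?_,
    fun i => div_nonneg (tailSum_pos hy _).le h0.le⟩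
  exact div_le_div_of_nonneg_right (antitone_tailSum hy (Fin.succ_le_succ_iff.2 hij)) h0.le

/-- In the coordinates `tailSum` the inverse branch is a shift with a new first entry. Dividing by
that entry gives the inverse of `branch b`. -/
theorem tailSum_inverseBranch_succ (b : ℕ) (y : Fin (m + 2) → ℝ) (i : Fin (m + 1)) :
    tailSum (inverseBranch b y) i.succ = tailSum y i.castSucc := by
  induction i using Fin.reverseInduction with
  | last => rw [Fin.succ_last, tailSum_last, inverseBranch_last, tailSum_castSucc, Fin.succ_last,
      tailSum_last]
  | cast i ih =>
    rw [Fin.succ_castSucc, tailSum_castSucc, ih, ← Fin.succ_castSucc, inverseBranch_succ_castSucc,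
      tailSum_castSucc y i.castSucc, Fin.succ_castSucc]

theorem tailSum_inverseBranch_zero (b : ℕ) (y : Fin (m + 2) → ℝ) :
    tailSum (inverseBranch b y) 0 =
      tailSum y 0 + tailSum y (Fin.last _) + b * tailSum y (Fin.last m).castSucc := by
  have h := tailSum_castSucc (inverseBranch b y) 0
  rw [tailSum_inverseBranch_succ, Fin.castSucc_zero] at h
  rw [h, inverseBranch_zero, tailSum_last, tailSum_castSucc y (Fin.last m), Fin.succ_last,
    tailSum_last]
  ring

theorem shape_inverseBranch_zero (b : ℕ) (y : Fin (m + 2) → ℝ) :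
    shape (inverseBranch b y) 0 = tailSum y 0 / tailSum (inverseBranch b y) 0 := by
  rw [shape, tailSum_inverseBranch_succ, Fin.castSucc_zero]

theorem one_sub_shape_inverseBranch {y : Fin (m + 2) → ℝ} (hy : y ∈ orthant m) (b : ℕ) :
    1 - shape (inverseBranch b y) 0 - b * shape (inverseBranch b y) (Fin.last m) =
      tailSum y (Fin.last _) / tailSum (inverseBranch b y) 0 := by
  have h0 := (tailSum_pos (inverseBranch_mem_orthant hy b) 0).ne'
  rw [shape_inverseBranch_zero, shape, tailSum_inverseBranch_succ]
  rw [eq_div_iff h0, sub_mul, sub_mul, div_mul_cancel₀ _ h0, mul_assoc, div_mul_cancel₀ _ h0,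
    tailSum_inverseBranch_zero]
  ring

theorem shape_inverseBranch_mem_piece {y : Fin (m + 2) → ℝ} (hy : y ∈ orthant m) (b : ℕ) :
    shape (inverseBranch b y) ∈ piece m b := by
  have hb := inverseBranch_mem_orthant hy b
  have h0 := tailSum_pos hb 0
  have h := one_sub_shape_inverseBranch hy b
  refine ⟨shape_mem_simplex hb, ?_, ?_⟩
  · rw [h]
    exact div_nonneg (tailSum_pos hy _).le h0.le
  · have h1 : shape (inverseBranch b y) (Fin.last m) =
        (y (Fin.last m).castSucc + tailSum y (Fin.last _)) / tailSum (inverseBranch b y) 0 := by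
      rw [shape, tailSum_inverseBranch_succ, tailSum_castSucc, Fin.succ_last]
    rw [add_mul, one_mul, ← sub_sub, h, h1, ← sub_div]
    exact div_neg_of_neg_of_pos (by linarith [hy (Fin.last m).castSucc]) h0

theorem branch_shape_inverseBranch {y : Fin (m + 2) → ℝ} (hy : y ∈ orthant m) (b : ℕ) :
    branch b (shape (inverseBranch b y)) = shape y := by
  have h0 := (tailSum_pos (inverseBranch_mem_orthant hy b) 0).ne'
  funext i
  induction i using Fin.lastCases with
  | last =>
    rw [branch, Fin.snoc_last, one_sub_shape_inverseBranch hy, shape_inverseBranch_zero,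
      div_div_div_cancel_right₀ h0, shape, Fin.succ_last]
  | cast i =>
    rw [branch, Fin.snoc_castSucc, shape_inverseBranch_zero, shape, tailSum_inverseBranch_succ,
      div_div_div_cancel_right₀ h0, shape, Fin.succ_castSucc]

theorem triangleMap_shape_inverseBranch {y : Fin (m + 2) → ℝ} (hy : y ∈ orthant m) (b : ℕ)
    {x : simplex (m + 1)} (hx : x.1 = shape (inverseBranch b y)) :
    (triangleMap m x).1 = shape y := by
  have h := mem_piece_iff.1 (shape_inverseBranch_mem_piece hy b)
  rw [← hx] at h
  rw [triangleMap, dif_neg h.2.1]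
  simp only [h.2.2]
  rw [hx, branch_shape_inverseBranch hy]

/-! ### Null sets of the simplex and of the cone over it -/

/-- By Fubini: the slice at height `t > 0` is `t • E`, whose volume is a positive multiple of that
of `E`. -/
theorem volume_cone_eq_zero_iff {E : Set (Fin (m + 1) → ℝ)} (hE : MeasurableSet E) :
    volume {x : Fin (m + 2) → ℝ | 0 < x 0 ∧ (fun i : Fin (m + 1) => x i.succ / x 0) ∈ E} = 0 ↔
      volume E = 0 := by
  have hp := volume_preserving_piFinSuccAbove (fun _ : Fin (m + 2) => ℝ) 0
  set S : Set (ℝ × (Fin (m + 1) → ℝ)) := {p | 0 < p.1 ∧ (fun i => p.2 i / p.1) ∈ E} with hS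
  have hSm : MeasurableSet S := by
    have h1 : Measurable fun p : ℝ × (Fin (m + 1) → ℝ) => fun i => p.2 i / p.1 := by fun_prop
    exact (measurableSet_lt measurable_const measurable_fst).inter (h1 hE)
  have hpre : {x : Fin (m + 2) → ℝ | 0 < x 0 ∧ (fun i : Fin (m + 1) => x i.succ / x 0) ∈ E} =
      MeasurableEquiv.piFinSuccAbove (fun _ : Fin (m + 2) => ℝ) 0 ⁻¹' S := rfl
  rw [hpre, hp.measure_preimage hSm.nullMeasurableSet, Measure.volume_eq_prod,
    Measure.measure_prod_null hSm]
  have hslice : ∀ t : ℝ, 0 < t → volume (Prod.mk t ⁻¹' S) =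
      ENNReal.ofReal (t ^ (m + 1)) * volume E := fun t ht => by
    have : Prod.mk t ⁻¹' S = t • E := by
      ext x
      rw [mem_smul_set_iff_inv_smul_mem₀ ht.ne']
      have : (fun i => x i / t) = t⁻¹ • x := by
        funext i
        simp [div_eq_inv_mul]
      simp [hS, ht, this]
    rw [this, Measure.addHaar_smul, Module.finrank_fintype_fun_eq_card, Fintype.card_fin,
      abs_of_pos (by positivity)]
  constructor
  · intro h
    by_contra hne
    have h1 : ∀ᵐ t : ℝ, t ≤ 0 := by
      filter_upwards [h] with t ht
      by_contra! ht0
      rw [hslice t ht0] at ht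
      simp only [Pi.zero_apply, mul_eq_zero, ENNReal.ofReal_eq_zero, hne, or_false] at ht
      exact absurd ht (not_le.2 (by positivity))
    have h2 : volume (Ioi (0 : ℝ)) = 0 := by
      rw [ae_iff] at h1
      simpa only [not_le, Ioi] using h1
    simp at h2
  · intro h
    refine Filter.Eventually.of_forall fun t => ?_
    rcases lt_or_ge 0 t with ht | ht
    · simp [hslice t ht, h]
    · have : Prod.mk t ⁻¹' S = ∅ := eq_empty_of_forall_notMem fun x hx => ht.not_gt hx.1
      simp [this]

theorem volume_orthant_inter_shape_eq_zero_iff {E : Set (Fin (m + 1) → ℝ)} (hE : MeasurableSet E)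
    (hs : E ⊆ simplex (m + 1)) :
    volume (orthant m ∩ shape ⁻¹' E) = 0 ↔ volume E = 0 := by
  rw [← volume_cone_eq_zero_iff hE]
  have hm : MeasurableSet
      {x : Fin (m + 2) → ℝ | 0 < x 0 ∧ (fun i : Fin (m + 1) => x i.succ / x 0) ∈ E} := by
    have h1 : Measurable fun x : Fin (m + 2) → ℝ => fun i : Fin (m + 1) => x i.succ / x 0 := by
      fun_prop
    exact (measurableSet_lt measurable_const (measurable_pi_apply 0)).inter (h1 hE)
  rw [← measurePreserving_tailSum.measure_preimage hm.nullMeasurableSet]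
  refine iff_of_eq (congrArg (· = 0) (measure_congr (Filter.eventuallyEq_set.2 ?_)))
  -- The simplex gives only weak inequalities for the `y i`; they are strict off the coordinate
  -- hyperplanes.
  have hne : ∀ᵐ y : Fin (m + 2) → ℝ, ∀ i, y i ≠ 0 :=
    ae_all_iff.2 fun i => Measure.ae_eval_ne _ _ _
  filter_upwards [hne] with y hy
  refine ⟨fun h => ⟨tailSum_pos h.1 0, h.2⟩, fun ⟨h0, h⟩ => ⟨fun i => ?_, h⟩⟩
  obtain ⟨h1, ha, hn⟩ := hs h
  refine lt_of_le_of_ne ?_ (hy i).symm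
  induction i using Fin.lastCases with
  | last =>
    have h2 : 0 ≤ tailSum y (Fin.last m).succ / tailSum y 0 := hn (Fin.last m)
    rw [Fin.succ_last, tailSum_last] at h2
    by_contra! h3
    exact absurd h2 (not_le.2 (div_neg_of_neg_of_pos h3 h0))
  | cast i =>
    suffices h2 : tailSum y i.succ ≤ tailSum y i.castSucc by
      rw [tailSum_castSucc] at h2
      linarith
    induction i using Fin.cases with
    | zero => exact (div_le_one h0).1 (h1 0)
    | succ i =>
      rw [← Fin.succ_castSucc]
      exact (div_le_div_iff_of_pos_right h0).1 (ha (Fin.castSucc_lt_succ (i := i)).le)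

/-- Dilates of the corner exhaust the orthant. -/
theorem IsConic.volume_eq_zero {S : Set (Fin (m + 2) → ℝ)} (hS : IsConic S) (ho : S ⊆ orthant m)
    (h : volume (corner 1 ∩ S) = 0) : volume S = 0 := by
  refine measure_mono_null (t := ⋃ n : ℕ, ((n : ℝ) + 1) • (corner 1 ∩ S)) (fun y hy => ?_)
    (measure_iUnion_null fun n => by rw [Measure.addHaar_smul, h, mul_zero])
  obtain ⟨n, hn⟩ := exists_nat_gt (∑ i, y i)
  have hn0 : (0 : ℝ) < n + 1 := by positivity
  refine mem_iUnion.2 ⟨n, (mem_smul_set_iff_inv_smul_mem₀ hn0.ne' _ _).2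
    ⟨⟨fun i => mul_pos (inv_pos.2 hn0) (ho hy i), ?_⟩, hS _ (inv_pos.2 hn0) _ hy⟩⟩
  rw [one_dotProduct]
  simp only [Pi.smul_apply, smul_eq_mul, ← Finset.mul_sum]
  rw [inv_mul_lt_iff₀ hn0]
  linarith

theorem measurableSet_simplex (n : ℕ) : MeasurableSet (simplex n) := by
  have h : simplex n = (⋂ i, {x | x i ≤ 1}) ∩
      ((⋂ i, ⋂ j, ⋂ _ : i ≤ j, {x | x j ≤ x i}) ∩ ⋂ i, {x | 0 ≤ x i}) := by
    ext x
    simp [simplex, Antitone]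
  rw [h]
  refine (isClosed_iInter fun i => ?_).inter ((isClosed_iInter fun i => isClosed_iInter fun j =>
    isClosed_iInter fun _ => ?_).inter (isClosed_iInter fun i => ?_)) |>.measurableSet
  · exact isClosed_le (continuous_apply i) continuous_const
  · exact isClosed_le (continuous_apply j) (continuous_apply i)
  · exact isClosed_le continuous_const (continuous_apply i)

/-! ### Transfer of the zero-one law to the simplex -/

/-- Lebesgue measure on the simplex. -/
noncomputable abbrev simplexMeasure (m : ℕ) : Measure (simplex (m + 1)) :=
  Measure.comap (Subtype.val : simplex (m + 1) → (Fin (m + 1) → ℝ)) volume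

theorem simplexMeasure_eq_zero_iff {A : Set (simplex (m + 1))} (hA : MeasurableSet A) :
    simplexMeasure m A = 0 ↔ volume (orthant m ∩ shape ⁻¹' (Subtype.val '' A)) = 0 := by
  rw [simplexMeasure, comap_subtype_coe_apply (measurableSet_simplex _),
    volume_orthant_inter_shape_eq_zero_iff ((measurableSet_simplex _).subtype_image hA)
      (by rintro _ ⟨x, -, rfl⟩; exact x.2)]

theorem shape_mem_image_iff {y : Fin (m + 2) → ℝ} (hy : y ∈ orthant m)
    {A : Set (simplex (m + 1))} :
    shape y ∈ Subtype.val '' A ↔ (⟨shape y, shape_mem_simplex hy⟩ : simplex (m + 1)) ∈ A := by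
  simp [shape_mem_simplex hy]

theorem shape_inverseBranch_mem_image_preimage_iff {y : Fin (m + 2) → ℝ} (hy : y ∈ orthant m)
    (b : ℕ) {A : Set (simplex (m + 1))} :
    shape (inverseBranch b y) ∈ Subtype.val '' (triangleMap m ⁻¹' A) ↔
      shape y ∈ Subtype.val '' A := by
  rw [shape_mem_image_iff (inverseBranch_mem_orthant hy b), shape_mem_image_iff hy, mem_preimage]
  refine iff_of_eq (congrArg (· ∈ A) (Subtype.ext ?_))
  exact triangleMap_shape_inverseBranch hy b rfl

theorem measurable_triangleMap : Measurable (triangleMap m) := by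
  have hb : Measurable fun x : Fin (m + 1) → ℝ => branch (digit x) x := by
    refine measurable_pi_iff.2 fun i => ?_
    induction i using Fin.lastCases with
    | last =>
      simp only [branch, Fin.snoc_last, digit]
      have h : Measurable fun x : Fin (m + 1) → ℝ => (⌊(1 - x 0) / x (Fin.last m)⌋₊ : ℝ) :=
        measurable_from_top.comp (Nat.measurable_floor.comp (by fun_prop))
      fun_prop
    | cast i =>
      simp only [branch, Fin.snoc_castSucc]
      fun_prop
  have hs : MeasurableSet {x : Fin (m + 1) → ℝ | x (Fin.last m) = 0} :=
    measurable_pi_apply _ (measurableSet_singleton 0)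
  refine MeasurableEmbedding.subtype_coe (measurableSet_simplex _) |>.measurable_comp_iff.1 ?_
  classical
  have h : Subtype.val ∘ triangleMap m = (fun x : Fin (m + 1) → ℝ =>
      if x (Fin.last m) = 0 then 0 else branch (digit x) x) ∘ Subtype.val := by
    funext x
    simp only [Function.comp_apply, triangleMap]
    split_ifs <;> rfl
  rw [h]
  exact (Measurable.ite hs measurable_const hb).comp measurable_subtype_coe

theorem quasiMeasurePreserving_triangleMap :
    Measure.QuasiMeasurePreserving (triangleMap m) (simplexMeasure m) (simplexMeasure m) := by
  refine ⟨measurable_triangleMap, Measure.AbsolutelyContinuous.mk fun A hA h0 => ?_⟩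
  rw [Measure.map_apply measurable_triangleMap hA,
    simplexMeasure_eq_zero_iff (measurable_triangleMap hA)]
  rw [simplexMeasure_eq_zero_iff hA] at h0
  -- Up to a null set, the cone over the preimage of `A` is covered by countably many
  -- volume-preserving images of the null cone over `A`.
  have hU : volume (⋃ b, inverseBranch b '' (orthant m ∩ shape ⁻¹' (Subtype.val '' A))) = 0 :=
    measure_iUnion_null fun b => by rw [volume_image_inverseBranch, h0]
  refine measure_mono_null_ae ?_ hU
  filter_upwards [ae_exists_inverseBranch_eq (m := m)] with y hy hyA
  obtain ⟨b, z, hz, rfl⟩ := hy hyA.1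
  exact mem_iUnion.2 ⟨b, z, ⟨hz, (shape_inverseBranch_mem_image_preimage_iff hz b).1 hyA.2⟩, rfl⟩

theorem isConic_shape_preimage (E : Set (Fin (m + 1) → ℝ)) :
    IsConic (orthant m ∩ shape ⁻¹' E) := fun t ht y hy =>
  ⟨fun i => mul_pos ht (hy.1 i), by rw [mem_preimage, shape_smul ht]; exact hy.2⟩

theorem preErgodic_triangleMap : PreErgodic (triangleMap m) (simplexMeasure m) := by
  refine ⟨fun A hA hinv => Filter.eventuallyConst_set'.2 ?_⟩
  have hE := (measurableSet_simplex (m + 1)).subtype_image hA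
  have hinvH : ∀ b, ∀ y ∈ orthant m, inverseBranch b y ∈ orthant m ∩ shape ⁻¹' (Subtype.val '' A) ↔
      y ∈ orthant m ∩ shape ⁻¹' (Subtype.val '' A) := fun b y hy => by
    have h := shape_inverseBranch_mem_image_preimage_iff hy b (A := A)
    rw [hinv] at h
    simp only [mem_inter_iff, mem_preimage, hy, inverseBranch_mem_orthant hy b, true_and, h]
  rcases volume_corner_inter_eq_zero_or (measurableSet_orthant.inter (measurable_shape hE))
    (isConic_shape_preimage _) hinvH with h | h
  · refine Or.inl (ae_eq_empty.2 ((simplexMeasure_eq_zero_iff hA).2 ?_))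
    exact (isConic_shape_preimage _).volume_eq_zero inter_subset_left h
  · refine Or.inr (ae_eq_univ.2 ((simplexMeasure_eq_zero_iff hA.compl).2 ?_))
    refine (isConic_shape_preimage _).volume_eq_zero inter_subset_left (measure_mono_null ?_ h)
    intro y hy
    refine ⟨hy.1, fun h' => ?_⟩
    exact (shape_mem_image_iff hy.1.1).1 hy.2.2 ((shape_mem_image_iff hy.1.1).1 h'.2)

end TriangleMap

/-- In every dimension `m + 1 ≥ 1`, the triangle map is ergodic for Lebesgue measure on the
simplex (the restriction of `volume`, as a measure on the subtype). Lebesgue measure is not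
invariant, so ergodicity is that of a map which is measurable and for which null sets have null
preimages: every measurable set `A` with `T⁻¹ A = A` is null or has null complement. -/
theorem mainTheorem1 (m : ℕ) :
    QuasiErgodic (TriangleMap.triangleMap m)
      (Measure.comap (Subtype.val : TriangleMap.simplex (m + 1) → (Fin (m + 1) → ℝ)) volume) :=
  ⟨TriangleMap.quasiMeasurePreserving_triangleMap, TriangleMap.preErgodic_triangleMap⟩
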